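/- **Setting.** Write $\mathbb T=\mathbb R/\mathbb Z$, $\mathbb T_N=\mathbb Z/N\mathbb Z$ and $\Omega_N=(\mathbb R^2)^{\mathbb T_N}$ with elements $\eta=(p_x,r_x)_{x\in\mathbb T_N}$. Fix $\beta>0$, a potential $V:\mathbb R\to\mathbb R$ and numbers $\gamma_N>0$. For $0<\kappa\le\alpha$ let $\eta(t)$ be the diffusion on $\Omega_N$ generated by $N^{1+\kappa}(\mathcal A_N+\gamma_N\mathcal S_N)$, where $$\mathcal A_N=\sum_x (p_x-p_{x-1})\partial_{r_x}+(V'(r_{x+1})-V'(r_x))\partial_{p_x},\qquad \mathcal S_N=-\tfrac12\sum_x\mathcal Y_x^*\mathcal Y_x,$$ $$\mathcal Y_x=\partial_{r_{x+1}}-\partial_{r_x},\qquad \mathcal Y_x^*=\beta(V'(r_{x+1})-V'(r_x))-\mathcal Y_x ,$$ started from an arbitrary law $\mu_{N,0}$; that is, with independent standard Brownian motions $B^x$ independent of $\eta(0)$, $\eta(t)$ solves $$dp_x=N^{1+\kappa}(V'(r_{x+1})-V'(r_x))\,dt,$$ $$dr_x=N^{1+\kappa}\Big[p_x-p_{x-1}+\tfrac{\beta\gamma_N}2\big(V'(r_{x+1})+V'(r_{x-1})-2V'(r_x)\big)\Big]dt+\sqrt{N^{1+\kappa}\gamma_N}\,(dB^{x-1}-dB^x).$$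 Let $\mu_{N,t}$ be the law of $\eta(t)$. Put $Z(\tau)=\int_{\mathbb R} e^{-\beta(V(r)-\tau r)}dr$, $\pi_\tau(dr)=Z(\tau)^{-1}e^{-\beta(V(r)-\tau r)}dr$, $G=\beta^{-1}\log Z$, $F(r)=\sup_\tau\{\tau r-G(\tau)\}$ and $\boldsymbol\tau=F'$. For a profile $(p,r):\mathbb T\to\mathbb R^2$, the product measure on $\Omega_N$ associated with it is the one under which, independently over $x$, $p_x$ is Gaussian with mean $p(x/N)$ and variance $\beta^{-1}$, and, independently of it, $r_x$ has law $\pi_{\boldsymbol\tau(r(x/N))}$. Fix $(\mathfrak p_*,\mathfrak r_*)\in\mathbb R^2$ and let $c_*=\sqrt{\boldsymbol\tau'(\mathfrak r_*)}$, $\mathbf u_\pm=(\pm c_*,1)$. Let $\sigma_\pm^{\rm ini}\in C^\infty(\mathbb T)$ have mean zero, and let $\sigma_\pm$ be smooth solutions on $[0,S)\times\mathbb T$, $S>0$, of $$\partial_s\sigma_\mp\pm\frac{\boldsymbol\tau''(\mathfrak r_*)}{4c_*}\partial_u(\sigma_\mp^2)=0,\qquad \sigma_\mp(0,\cdot)=\sigma_\mp^{\rm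 ini}.$$ Let $T>0$, with $T<S$ if $\kappa=\alpha$ ($T$ is arbitrary if $\kappa<\alpha$). With $s=N^{\kappa-\alpha}t$ and $u_\pm=u\pm N^\kappa c_*t$ put $$(\mathfrak p_N,\mathfrak r_N)(t,u)=(\mathfrak p_*,\mathfrak r_*)+N^{-\alpha}\sum_{j=\pm}\sigma_j(s,u_j)\mathbf u_j,$$ $$(\tilde{\mathfrak p}_N,\tilde{\mathfrak r}_N)(t,u)=(\mathfrak p_N,\mathfrak r_N)(t,u)+N^{-2\alpha}\sum_{j=\pm}\tilde\sigma_j(s,u_-,u_+)\mathbf u_j,$$ where, with $\Sigma_\pm(s,u)=\int_0^u\sigma_\pm(s,v)dv$, with $\boldsymbol\tau',\boldsymbol\tau''$ taken at $\mathfrak r_*$, and with $\sigma_-,\Sigma_-$ evaluated at $(s,u_-)$ and $\sigma_+,\Sigma_+$ at $(s,u_+)$, $$\tilde\sigma_-=-\frac{\boldsymbol\tau''}{8\boldsymbol\tau'}\sigma_+^2-\frac{\boldsymbol\tau''}{4\boldsymbol\tau'}\big[\partial_u\sigma_-\,\Sigma_++\sigma_-\sigma_+\big],\qquad \tilde\sigma_+=-\frac{\boldsymbol\tau''}{8\boldsymbol\tau'}\sigma_-^2-\frac{\boldsymbol\tau''}{4\boldsymbol\tau'}\big[\sigma_-\sigma_++\Sigma_-\,\partial_u\sigma_+\big].$$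 Let $\nu_{N,t}$ and $\tilde\nu_{N,t}$ be the product measures associated with $(\mathfrak p_N,\mathfrak r_N)(t,\cdot)$ and $(\tilde{\mathfrak p}_N,\tilde{\mathfrak r}_N)(t,\cdot)$. Put $\tilde f_{N,t}=d\mu_{N,t}/d\tilde\nu_{N,t}$, $\tilde{\mathfrak r}_x^N=\tilde{\mathfrak r}_N(t,x/N)$, let $H_N(t)$ be the relative entropy of $\mu_{N,t}$ with respect to $\nu_{N,t}$, and $$\mathcal R_{N,t}=\int_{\Omega_N}\tilde f_{N,t}\sum_{x\in\mathbb T_N}\frac{d\tilde{\mathfrak r}^N_x}{dt}\big[V'(r_x)-\boldsymbol\tau(\tilde{\mathfrak r}^N_x)-\boldsymbol\tau'(\tilde{\mathfrak r}^N_x)(r_x-\tilde{\mathfrak r}^N_x)\big]\,d\tilde\nu_{N,t}.$$ **Corollary (Harmonic chain).** Suppose that $V(r)=kr^2$ with $k>0$. Then: 1. $\mathcal R_{N,t}=0$ for all $N$ and all $t\in[0,T]$ (and its integrand is integrable). Suppose moreover that $\alpha<\frac12$, $\kappa<\frac{1-2\alpha}3$, $N^{5\kappa+4\alpha-1}\ll\gamma_N\ll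 N^{1-\kappa}$ and $H_N(0)=o(N^{1-2\alpha})$ as $N\to\infty$. Then: 2. $H_N(t)=o(N^{1-2\alpha})$ for every $t\in[0,T]$. 3. For every $t\in[0,T]$, $\varphi\in C(\mathbb T)$, $\varepsilon>0$ and each choice of sign, $$\lim_{N\to\infty}\mu_{N,t}\bigg\{\bigg|\frac1{N^{1-\alpha}}\sum_{x\in\mathbb T_N}\Big(\frac{r_x-\mathfrak r_*}2\pm\frac{p_x-\mathfrak p_*}{2c_*}\Big)\varphi\Big(\frac xN\pm N^\kappa c_*t\Big)-\int_{\mathbb T}\sigma_\pm^{(\alpha,\kappa)}(t,u)\varphi(u)\,du\bigg|>\varepsilon\bigg\}=0,$$ where $\sigma_\pm^{(\alpha,\kappa)}(t,u)=\sigma_\pm(t,u)$ if $\kappa=\alpha$ and $\sigma_\pm^{(\alpha,\kappa)}(t,u)=\sigma_\pm^{\rm ini}(u)$ if $\kappa<\alpha$. -/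

import Mathlib

open MeasureTheory ProbabilityTheory InformationTheory Filter Topology
open scoped NNReal ENNReal Asymptotics

noncomputable section

namespace OscillatorChain

/-! ### Configurations -/

/-- A configuration `(p_x, r_x)`, `x ∈ 𝕋_N`. The discrete circle `𝕋_N = ℤ / Nℤ` is represented by
`Fin N`, with the cyclic neighbours `succ x = x + 1` and `pred x = x - 1`. -/
abbrev Config (N : ℕ) : Type := Fin N → ℝ × ℝ

/-- The right neighbour `x + 1` on the discrete circle. -/
def succ {N : ℕ} (x : Fin N) : Fin N := finRotate N x

/-- The left neighbour `x - 1` on the discrete circle. -/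
def pred {N : ℕ} (x : Fin N) : Fin N := (finRotate N).symm x

/-! ### Equilibrium thermodynamics of a pair potential `V` at inverse temperature `β` -/

/-- The partition function `Z(τ) = ∫ exp (-β (V r - τ r)) dr`. -/
def partitionFn (β : ℝ) (V : ℝ → ℝ) (τ : ℝ) : ℝ :=
  ∫ r, Real.exp (-β * (V r - τ * r))

/-- The Gibbs potential `G(τ) = β⁻¹ log Z(τ)`. -/
def gibbsPotential (β : ℝ) (V : ℝ → ℝ) (τ : ℝ) : ℝ :=
  β⁻¹ * Real.log (partitionFn β V τ)

/-- The free energy `F(r) = sup_τ (τ r - G(τ))`. -/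
def freeEnergy (β : ℝ) (V : ℝ → ℝ) (r : ℝ) : ℝ :=
  ⨆ τ : ℝ, (τ * r - gibbsPotential β V τ)

/-- The equilibrium tension `𝛕(r) = F'(r)`. -/
def tension (β : ℝ) (V : ℝ → ℝ) (r : ℝ) : ℝ :=
  deriv (freeEnergy β V) r

/-- `𝛕'(r)`. -/
def tension' (β : ℝ) (V : ℝ → ℝ) (r : ℝ) : ℝ :=
  deriv (tension β V) r

/-- `𝛕''(r)`. -/
def tension'' (β : ℝ) (V : ℝ → ℝ) (r : ℝ) : ℝ :=
  deriv (tension' β V) r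

/-- The law `π_τ(dr) = Z(τ)⁻¹ exp (-β (V r - τ r)) dr` of one inter-particle distance. -/
def lengthGibbs (β : ℝ) (V : ℝ → ℝ) (τ : ℝ) : Measure ℝ :=
  volume.withDensity fun r =>
    ENNReal.ofReal (Real.exp (-β * (V r - τ * r)) / partitionFn β V τ)

/-- The one-site Gibbs state with mean momentum `p` and tension `τ`: the momentum is Gaussian with
mean `p` and variance `β⁻¹`, and it is independent of the length, which has law `π_τ`. -/
def siteGibbs (β : ℝ) (V : ℝ → ℝ) (p τ : ℝ) : Measure (ℝ × ℝ) :=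
  (gaussianReal p (β⁻¹).toNNReal).prod (lengthGibbs β V τ)

/-! ### The dynamics -/

/-- `η` is the chain of `N` oscillators with pair potential `V`, inverse temperature `β` and
noise strength `γ`, run at speed `a`. That is, `η` is the diffusion with generator
`a (𝓐 + γ 𝓢)`, where
`𝓐 = ∑ₓ (pₓ - pₓ₋₁) ∂/∂rₓ + (V'(rₓ₊₁) - V'(rₓ)) ∂/∂pₓ` and `𝓢 = -(1/2) ∑ₓ 𝓨ₓ* 𝓨ₓ`,
`𝓨ₓ = ∂/∂rₓ₊₁ - ∂/∂rₓ`, `𝓨ₓ* = β (V'(rₓ₊₁) - V'(rₓ)) - 𝓨ₓ`,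
realised as a solution of the stochastic differential equation
`dpₓ = a (V'(rₓ₊₁) - V'(rₓ)) dt`,
`drₓ = a (pₓ - pₓ₋₁) dt + a (β γ / 2) (V'(rₓ₊₁) + V'(rₓ₋₁) - 2 V'(rₓ)) dt
  + √(a γ) (dBˣ⁻¹ - dBˣ)`,
with independent standard Brownian motions `Bˣ`, jointly independent of the initial state.
The noise is additive, so the equation in integral form contains no stochastic integral. -/
structure IsOscillatorChain {Ω : Type*} [MeasurableSpace Ω] (P : Measure Ω) {N : ℕ}
    (β : ℝ) (V : ℝ → ℝ) (γ a : ℝ)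
    (B : Fin N → ℝ≥0 → Ω → ℝ) (η : ℝ → Ω → Config N) : Prop where
  measurable_noise : ∀ x t, Measurable (B x t)
  brownian : ∀ x, IsBrownianReal (B x) P
  indep_noise : iIndepFun (fun x (ω : Ω) (t : ℝ≥0) => B x t ω) P
  indep_initial : IndepFun (η 0) (fun (ω : Ω) (x : Fin N) (t : ℝ≥0) => B x t ω) P
  measurable_state : ∀ t, Measurable (η t)
  continuous_path : ∀ᵐ ω ∂P, ContinuousOn (fun t => η t ω) (Set.Ici 0)
  momentum_eq : ∀ᵐ ω ∂P, ∀ t, 0 ≤ t → ∀ x,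
    (η t ω x).1 = (η 0 ω x).1
      + ∫ s in (0 : ℝ)..t, a * (deriv V (η s ω (succ x)).2 - deriv V (η s ω x).2)
  length_eq : ∀ᵐ ω ∂P, ∀ t, 0 ≤ t → ∀ x,
    (η t ω x).2 = (η 0 ω x).2
      + (∫ s in (0 : ℝ)..t, a * ((η s ω x).1 - (η s ω (pred x)).1
          + β * γ / 2 * (deriv V (η s ω (succ x)).2 + deriv V (η s ω (pred x)).2
              - 2 * deriv V (η s ω x).2)))
      + √(a * γ) * (B (pred x) t.toNNReal ω - B x t.toNNReal ω)

/-! ### Burgers equation -/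

/-- `σ` is a smooth (classical) solution on `[0, S) × 𝕋` of `∂ₛ σ + c ∂ᵤ (σ²) = 0`, with
`σ(0, ·) = σIni`. Functions on the circle `𝕋 = ℝ / ℤ` are 1-periodic functions on `ℝ`. -/
structure IsBurgersSolution (c S : ℝ) (σIni : ℝ → ℝ) (σ : ℝ → ℝ → ℝ) : Prop where
  smooth : ContDiffOn ℝ (⊤ : ℕ∞) (fun z : ℝ × ℝ => σ z.1 z.2) (Set.Ico 0 S ×ˢ Set.univ)
  periodic : ∀ s ∈ Set.Ico 0 S, Function.Periodic (σ s) 1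
  initial : ∀ u, σ 0 u = σIni u
  equation : ∀ s ∈ Set.Ioo 0 S, ∀ u,
    deriv (fun s' => σ s' u) s + c * deriv (fun u' => σ s u' ^ 2) u = 0

/-! ### Perturbed profiles and reference measures -/

/-- The parameters of the scaling problem: the inverse temperature `β`, the potential `V`, the
noise strengths `γ_N`, the exponents `α`, `κ`, the equilibrium point `(p_*, r_*)`, and the
amplitudes `σ_-` and `σ_+` of the two waves with their initial values. -/
structure ChainData where
  β : ℝ
  V : ℝ → ℝ
  γ : ℕ → ℝ
  α : ℝ
  κ : ℝ
  pStar : ℝ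
  rStar : ℝ
  σmIni : ℝ → ℝ
  σpIni : ℝ → ℝ
  σm : ℝ → ℝ → ℝ
  σp : ℝ → ℝ → ℝ

namespace ChainData

variable (D : ChainData)

/-- The macroscopic sound speed `√𝛕'(r_*)`. -/
def speed : ℝ := √(tension' D.β D.V D.rStar)

/-- The coefficient `𝛕''(r_*) / (4 √𝛕'(r_*))` of the Burgers equations. -/
def burgersCoeff : ℝ := tension'' D.β D.V D.rStar / (4 * D.speed)

/-- The slow time `s = N^(κ-α) t`. -/
def slowTime (N : ℕ) (t : ℝ) : ℝ := (N : ℝ) ^ (D.κ - D.α) * t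

/-- The characteristic coordinate `u_- = u - N^κ √𝛕'(r_*) t`. -/
def um (N : ℕ) (t u : ℝ) : ℝ := u - (N : ℝ) ^ D.κ * D.speed * t

/-- The characteristic coordinate `u_+ = u + N^κ √𝛕'(r_*) t`. -/
def up (N : ℕ) (t u : ℝ) : ℝ := u + (N : ℝ) ^ D.κ * D.speed * t

/-- The momentum profile `𝔭_N(t, u)`. -/
def pProfile (N : ℕ) (t u : ℝ) : ℝ :=
  D.pStar + (N : ℝ) ^ (-D.α) *
    (D.σp (D.slowTime N t) (D.up N t u) * D.speed
      - D.σm (D.slowTime N t) (D.um N t u) * D.speed)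

/-- The length profile `𝔯_N(t, u)`. -/
def rProfile (N : ℕ) (t u : ℝ) : ℝ :=
  D.rStar + (N : ℝ) ^ (-D.α) *
    (D.σp (D.slowTime N t) (D.up N t u) + D.σm (D.slowTime N t) (D.um N t u))

/-- The primitive `Σ_-(s, u) = ∫₀ᵘ σ_-(s, v) dv`. -/
def primm (s u : ℝ) : ℝ := ∫ v in (0 : ℝ)..u, D.σm s v

/-- The primitive `Σ_+(s, u) = ∫₀ᵘ σ_+(s, v) dv`. -/
def primp (s u : ℝ) : ℝ := ∫ v in (0 : ℝ)..u, D.σp s v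

/-- The second order corrector `σ̃_-(s, u_-, u_+)`. -/
def corrm (s a b : ℝ) : ℝ :=
  -(tension'' D.β D.V D.rStar / (8 * tension' D.β D.V D.rStar)) * D.σp s b ^ 2
    - tension'' D.β D.V D.rStar / (4 * tension' D.β D.V D.rStar) *
      (deriv (D.σm s) a * D.primp s b + D.σm s a * D.σp s b)

/-- The second order corrector `σ̃_+(s, u_-, u_+)`. -/
def corrp (s a b : ℝ) : ℝ :=
  -(tension'' D.β D.V D.rStar / (8 * tension' D.β D.V D.rStar)) * D.σm s a ^ 2
    - tension'' D.β D.V D.rStar / (4 * tension' D.β D.V D.rStar) *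
      (D.σm s a * D.σp s b + D.primm s a * deriv (D.σp s) b)

/-- The corrected momentum profile. -/
def pTilde (N : ℕ) (t u : ℝ) : ℝ :=
  D.pProfile N t u + (N : ℝ) ^ (-2 * D.α) *
    (D.corrp (D.slowTime N t) (D.um N t u) (D.up N t u) * D.speed
      - D.corrm (D.slowTime N t) (D.um N t u) (D.up N t u) * D.speed)

/-- The corrected length profile. -/
def rTilde (N : ℕ) (t u : ℝ) : ℝ :=
  D.rProfile N t u + (N : ℝ) ^ (-2 * D.α) *
    (D.corrp (D.slowTime N t) (D.um N t u) (D.up N t u)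
      + D.corrm (D.slowTime N t) (D.um N t u) (D.up N t u))

/-- The product measure `ν_{N,t}` associated with the profile `(𝔭_N, 𝔯_N)(t, ·)`. -/
def refMeasure (N : ℕ) (t : ℝ) : Measure (Config N) :=
  Measure.pi fun x : Fin N =>
    siteGibbs D.β D.V (D.pProfile N t ((x : ℝ) / N)) (tension D.β D.V (D.rProfile N t ((x : ℝ) / N)))

/-- The product measure `ν̃_{N,t}` associated with the corrected profile. -/
def refMeasureTilde (N : ℕ) (t : ℝ) : Measure (Config N) :=
  Measure.pi fun x : Fin N =>
    siteGibbs D.β D.V (D.pTilde N t ((x : ℝ) / N)) (tension D.β D.V (D.rTilde N t ((x : ℝ) / N)))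

/-- The integrand of `R_{N,t}` with respect to `ν̃_{N,t}`, when the law at time `t` is `μ`:
`f̃ ∑ₓ (d r̃ₓ / dt) (V'(rₓ) - 𝛕(r̃ₓ) - 𝛕'(r̃ₓ) (rₓ - r̃ₓ))`, with `f̃ = dμ / dν̃_{N,t}`. -/
def remainderIntegrand (N : ℕ) (t : ℝ) (μ : Measure (Config N)) (η : Config N) : ℝ :=
  (μ.rnDeriv (D.refMeasureTilde N t) η).toReal *
    ∑ x : Fin N, derivWithin (fun t' => D.rTilde N t' ((x : ℝ) / N)) (Set.Ici 0) t *
      (deriv D.V (η x).2 - tension D.β D.V (D.rTilde N t ((x : ℝ) / N))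
        - tension' D.β D.V (D.rTilde N t ((x : ℝ) / N)) *
          ((η x).2 - D.rTilde N t ((x : ℝ) / N)))

/-- The term `R_{N,t}`, when the law at time `t` is `μ`. -/
def remainder (N : ℕ) (t : ℝ) (μ : Measure (Config N)) : ℝ :=
  ∫ η, D.remainderIntegrand N t μ η ∂(D.refMeasureTilde N t)

open Classical in
/-- The macroscopic profile `σ_-^{(α,κ)}`. -/
def limitm (t u : ℝ) : ℝ := if D.κ = D.α then D.σm t u else D.σmIni u

open Classical in
/-- The macroscopic profile `σ_+^{(α,κ)}`. -/
def limitp (t u : ℝ) : ℝ := if D.κ = D.α then D.σp t u else D.σpIni u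

/-- The empirical field of the `-` mode along its characteristic, tested against `φ`. -/
def fieldm (N : ℕ) (t : ℝ) (φ : ℝ → ℝ) (η : Config N) : ℝ :=
  1 / (N : ℝ) ^ (1 - D.α) * ∑ x : Fin N,
    (((η x).2 - D.rStar) / 2 - ((η x).1 - D.pStar) / (2 * D.speed)) * φ (D.um N t ((x : ℝ) / N))

/-- The empirical field of the `+` mode along its characteristic, tested against `φ`. -/
def fieldp (N : ℕ) (t : ℝ) (φ : ℝ → ℝ) (η : Config N) : ℝ :=
  1 / (N : ℝ) ^ (1 - D.α) * ∑ x : Fin N,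
    (((η x).2 - D.rStar) / 2 + ((η x).1 - D.pStar) / (2 * D.speed)) * φ (D.up N t ((x : ℝ) / N))

end ChainData

end OscillatorChain

end

/-! For `V r = k r ^ 2` the tension is linear, `𝛕(r) = 2 k r`. The bracket in `R_{N,t}` is then zero
pointwise, which is the first claim. Since `𝛕'' = 0`, the Burgers coefficient vanishes and `σ_±` do
not depend on the slow time. The reference measure at time `t` is therefore a product of Gaussians
with fixed variances `β⁻¹` and `(2 k β)⁻¹`, and its mean is a superposition of two travelling waves.

The chain itself is an Ornstein–Uhlenbeck process `dη = A η dt + noise`. Its law at time `t` is the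
law of `e^{tA} η(0) + ξ` with `ξ` Gaussian and independent of `η(0)` (`exists_map_eq_prod_map`). The
Lyapunov equation says that the same operation maps the Gaussian product with mean `m` to the one
with mean `e^{tA} m` (`sum_drift_eq_sum_noiseDir`, `integral_noiseDir_eq`). By data processing, the
entropy of the law relative to this transported measure does not increase
(`IsOscillatorChain.klDiv_map_le`).

It remains to replace the mean `e^{tA} m(0)` by the wave `m(t)`. By Cameron–Martin and the entropy
inequality this costs a factor 2 and the weighted squared distance of the means
(`klDiv_gaussProd_le`). The drift is dissipative for that quadratic form, and by Taylor expansion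
the waves solve the lattice equation up to a second order error. Grönwall then bounds the distance
by a constant times `N^(1-2α) (N^(κ-1) (1+γ_N))²` (`energy_waveProfile_sub_exp_le`), which is
`o(N^(1-2α))` because `γ_N ≪ N^(1-κ)`.

Finally, the empirical fields are affine in the configuration, with variance of order `N^(-(1-2α))`
under the reference measure. The entropy inequality makes them concentrate around their reference
means (`tendsto_measure_field`), and these means are Riemann sums converging to the integrals of
`σ_±^{ini} φ`. -/

namespace OscillatorChain

/-! ### Thermodynamics of the harmonic potential: all Gibbs measures are Gaussian. -/

section Thermodynamics

variable {β k : ℝ}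

theorem partitionFn_harmonic (hβ : 0 < β) (hk : 0 < k) (τ : ℝ) :
    partitionFn β (fun r => k * r ^ 2) τ =
      Real.exp (β * τ ^ 2 / (4 * k)) * √(Real.pi / (β * k)) := by
  have h : ∀ r : ℝ, Real.exp (-β * (k * r ^ 2 - τ * r)) =
      Real.exp (β * τ ^ 2 / (4 * k)) * Real.exp (-(β * k) * (r - τ / (2 * k)) ^ 2) := by
    intro r
    rw [← Real.exp_add]
    congr 1
    field_simp
    ring
  simp only [partitionFn, h]
  rw [integral_const_mul,
    integral_sub_right_eq_self (fun r : ℝ => Real.exp (-(β * k) * r ^ 2)), integral_gaussian]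

theorem gibbsPotential_harmonic (hβ : 0 < β) (hk : 0 < k) (τ : ℝ) :
    gibbsPotential β (fun r => k * r ^ 2) τ =
      τ ^ 2 / (4 * k) + β⁻¹ * Real.log √(Real.pi / (β * k)) := by
  rw [gibbsPotential, partitionFn_harmonic hβ hk, Real.log_mul (Real.exp_pos _).ne', Real.log_exp]
  · field_simp
  · have := Real.pi_pos
    positivity

theorem freeEnergy_harmonic (hβ : 0 < β) (hk : 0 < k) (r : ℝ) :
    freeEnergy β (fun r => k * r ^ 2) r = k * r ^ 2 - β⁻¹ * Real.log √(Real.pi / (β * k)) := by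
  -- The concave function `τ r - τ² / (4k) - const` is maximal at `τ = 2 k r`. The upper bound below
  -- is the square `(τ - 2 k r)² ≥ 0`.
  refine IsGreatest.csSup_eq ⟨⟨2 * k * r, ?_⟩, ?_⟩
  · simp only [gibbsPotential_harmonic hβ hk]
    field_simp
    ring
  · rintro _ ⟨τ, rfl⟩
    simp only [gibbsPotential_harmonic hβ hk]
    have : τ * r ≤ τ ^ 2 / (4 * k) + k * r ^ 2 := by
      have h : 0 ≤ (τ - 2 * k * r) ^ 2 / (4 * k) := by positivity
      have e : (τ - 2 * k * r) ^ 2 / (4 * k) = τ ^ 2 / (4 * k) + k * r ^ 2 - τ * r := by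
        field_simp
        ring
      linarith
    linarith

theorem tension_harmonic (hβ : 0 < β) (hk : 0 < k) (r : ℝ) :
    tension β (fun r => k * r ^ 2) r = 2 * k * r := by
  rw [tension, funext (freeEnergy_harmonic hβ hk)]
  have h : HasDerivAt (fun r : ℝ => k * r ^ 2 - β⁻¹ * Real.log √(Real.pi / (β * k)))
      (k * (2 * r)) r := by
    simpa using (((hasDerivAt_pow 2 r).const_mul k).sub_const
      (β⁻¹ * Real.log √(Real.pi / (β * k))))
  rw [h.deriv]
  ring

theorem tension'_harmonic (hβ : 0 < β) (hk : 0 < k) (r : ℝ) :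
    tension' β (fun r => k * r ^ 2) r = 2 * k := by
  rw [tension', funext (tension_harmonic hβ hk)]
  simp

theorem tension''_harmonic (hβ : 0 < β) (hk : 0 < k) (r : ℝ) :
    tension'' β (fun r => k * r ^ 2) r = 0 := by
  rw [tension'', funext (tension'_harmonic hβ hk), deriv_const]

/-- Completing the square. The point is that the variance does not depend on `r`, so that the
reference measures for different profiles are translates of one another. -/
theorem lengthGibbs_harmonic (hβ : 0 < β) (hk : 0 < k) (r : ℝ) :
    lengthGibbs β (fun r => k * r ^ 2) (2 * k * r) =
      gaussianReal r ((2 * k * β)⁻¹).toNNReal := by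
  have hpos : 0 < (2 * k * β)⁻¹ := by positivity
  rw [gaussianReal_of_var_ne_zero _ (by simpa using hpos), lengthGibbs]
  congr 1
  funext y
  rw [gaussianPDF_def, gaussianPDFReal_def, partitionFn_harmonic hβ hk]
  congr 1
  rw [Real.coe_toNNReal _ hpos.le, div_eq_mul_inv, mul_inv, ← mul_assoc, ← Real.exp_neg,
    ← Real.exp_add, mul_comm]
  congr 2
  · congr 1
    field_simp
  · field_simp
    ring

theorem siteGibbs_harmonic (hβ : 0 < β) (hk : 0 < k) (p r : ℝ) :
    siteGibbs β (fun r => k * r ^ 2) p (tension β (fun r => k * r ^ 2) r) =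
      (gaussianReal p (β⁻¹).toNNReal).prod (gaussianReal r ((2 * k * β)⁻¹).toNNReal) := by
  rw [siteGibbs, tension_harmonic hβ hk, lengthGibbs_harmonic hβ hk]

end Thermodynamics

/-! ### Gaussian product measures and their linear functionals. -/

section GaussianProduct

variable {N : ℕ}

/-- The unit vector of the momentum at `x`. -/
def momentumUnit (x : Fin N) : Config N := Pi.single x (1, 0)

/-- The unit vector of the length at `x`. -/
def lengthUnit (x : Fin N) : Config N := Pi.single x (0, 1)

/-- The law of independent Gaussian momenta of variance `v` and lengths of variance `w`, with
means `m`. -/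
noncomputable def gaussProd (v w : ℝ≥0) (m : Config N) : Measure (Config N) :=
  Measure.pi fun x => (gaussianReal (m x).1 v).prod (gaussianReal (m x).2 w)

instance (v w : ℝ≥0) (m : Config N) : IsProbabilityMeasure (gaussProd v w m) := by
  unfold gaussProd; infer_instance

/-- The variance of a linear functional under `gaussProd v w m`. -/
noncomputable def dualVar (v w : ℝ≥0) (L : StrongDual ℝ (Config N)) : ℝ :=
  ∑ x, (v * L (momentumUnit x) ^ 2 + w * L (lengthUnit x) ^ 2)

theorem dualVar_nonneg (v w : ℝ≥0) (L : StrongDual ℝ (Config N)) : 0 ≤ dualVar v w L :=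
  Finset.sum_nonneg fun x _ => by positivity

theorem eq_sum_units (h : Config N) :
    h = ∑ x, ((h x).1 • momentumUnit x + (h x).2 • lengthUnit x) := by
  conv_lhs => rw [← Finset.univ_sum_single h]
  refine Finset.sum_congr rfl fun x _ => ?_
  rw [momentumUnit, lengthUnit, ← Pi.single_smul, ← Pi.single_smul, ← Pi.single_add]
  simp

theorem dual_apply (L : StrongDual ℝ (Config N)) (h : Config N) :
    L h = ∑ x, ((h x).1 * L (momentumUnit x) + (h x).2 * L (lengthUnit x)) := by
  conv_lhs => rw [eq_sum_units h]
  simp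

theorem charFunDual_gaussProd (v w : ℝ≥0) (m : Config N) (L : StrongDual ℝ (Config N)) :
    charFunDual (gaussProd v w m) L =
      Complex.exp (L m * Complex.I - dualVar v w L / 2) := by
  have key : ∀ (a : ℝ) (u : ℝ≥0) (l : StrongDual ℝ ℝ), charFunDual (gaussianReal a u) l =
      Complex.exp (a * l 1 * Complex.I - u * l 1 ^ 2 / 2) := by
    intro a u l
    have : charFunDual (gaussianReal a u) l = charFun (gaussianReal a u) (l 1) := by
      rw [charFunDual_apply, charFun_apply_real]
      congr 1
      funext y
      have : l y = l 1 * y := by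
        have := l.map_smul y 1
        simp only [smul_eq_mul, mul_one] at this
        rw [this, mul_comm]
      rw [this]
      push_cast
      ring_nf
    rw [this, charFun_gaussianReal]
    ring_nf
  rw [gaussProd, charFunDual_pi]
  simp only [charFunDual_prod, key, ← Complex.exp_add, ← Complex.exp_sum]
  congr 1
  rw [dual_apply L m, dualVar]
  push_cast
  rw [Finset.sum_mul, Finset.sum_div, ← Finset.sum_sub_distrib]
  refine Finset.sum_congr rfl fun x _ => ?_
  change _ + (((m x).2 : ℂ) * (L (lengthUnit x) : ℂ) * Complex.I -
    w * (L (lengthUnit x) : ℂ) ^ 2 / 2) = _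
  change ((m x).1 : ℂ) * (L (momentumUnit x) : ℂ) * Complex.I -
    v * (L (momentumUnit x) : ℂ) ^ 2 / 2 + _ = _
  ring

theorem gaussProd_map_dual (v w : ℝ≥0) (m : Config N) (L : StrongDual ℝ (Config N)) :
    (gaussProd v w m).map L = gaussianReal (L m) (dualVar v w L).toNNReal := by
  have : IsProbabilityMeasure ((gaussProd v w m).map L) :=
    Measure.isProbabilityMeasure_map L.continuous.aemeasurable
  refine Measure.ext_of_charFun (funext fun t => ?_)
  have h := charFunDual_gaussProd v w m (t • L)
  rw [charFunDual_apply] at h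
  rw [charFun_gaussianReal, charFun_apply_real,
    integral_map L.continuous.aemeasurable (by fun_prop)]
  rw [Real.coe_toNNReal _ (dualVar_nonneg v w L)]
  have hq : dualVar v w (t • L) = dualVar v w L * t ^ 2 := by
    rw [dualVar, dualVar, Finset.sum_mul]
    refine Finset.sum_congr rfl fun x _ => ?_
    simp only [smul_apply, smul_eq_mul]
    ring
  rw [hq] at h
  simpa using h

end GaussianProduct

/-! ### The entropy inequality and tilting of the reference measure. -/

section EntropyInequality

/-- Young's inequality for the convex conjugates `g log g - g` and `exp y`. Since `klFun g = g log g
+ 1 - g`, there is a slack of 1. -/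
theorem mul_le_klFun_add_exp {g : ℝ} (hg : 0 ≤ g) (y : ℝ) : g * y ≤ klFun g + Real.exp y := by
  rw [klFun_apply]
  rcases hg.eq_or_lt with rfl | hg
  · have := Real.exp_pos y
    simp only [zero_mul]
    linarith
  · have h1 := mul_le_mul_of_nonneg_left (Real.add_one_le_exp (y - Real.log g)) hg.le
    rw [Real.exp_sub, Real.exp_log hg, mul_div_cancel₀ _ hg.ne'] at h1
    nlinarith

variable {α : Type*} [MeasurableSpace α] {μ ν : Measure α} [IsProbabilityMeasure μ]
  [IsProbabilityMeasure ν] {f : α → ℝ}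

/-- With `g = dμ/dν`, Young's inequality gives `g |f| ≤ klFun g + exp |f|`, and `exp |f| ≤ exp f +
exp (-f)`. All three terms are `ν`-integrable. -/
theorem integrable_of_klDiv_ne_top (h : klDiv μ ν ≠ ⊤) (hf : Measurable f)
    (h1 : Integrable (fun x => Real.exp (f x)) ν) (h2 : Integrable (fun x => Real.exp (-f x)) ν) :
    Integrable f μ := by
  obtain ⟨hac, hint⟩ := klDiv_ne_top_iff.1 h
  rw [← integrable_rnDeriv_smul_iff hac]
  refine Integrable.mono' (((integrable_klFun_rnDeriv_iff hac).2 hint).add (h1.add h2))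
    (by fun_prop) (ae_of_all _ fun x => ?_)
  have hg : 0 ≤ (μ.rnDeriv ν x).toReal := ENNReal.toReal_nonneg
  simp only [smul_eq_mul, Real.norm_eq_abs, abs_mul, abs_of_nonneg hg, Pi.add_apply]
  refine (mul_le_klFun_add_exp hg _).trans (add_le_add_right (Real.exp_abs_le _) _)

/-- The entropy inequality. -/
theorem integral_le_klDiv_add_log (h : klDiv μ ν ≠ ⊤) (hf : Measurable f)
    (h1 : Integrable (fun x => Real.exp (f x)) ν) (h2 : Integrable (fun x => Real.exp (-f x)) ν) :
    ∫ x, f x ∂μ ≤ (klDiv μ ν).toReal + Real.log (∫ x, Real.exp (f x) ∂ν) := by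
  obtain ⟨hac, hint⟩ := klDiv_ne_top_iff.1 h
  have hfμ := integrable_of_klDiv_ne_top h hf h1 h2
  have := isProbabilityMeasure_tilted h1
  -- Donsker–Varadhan: the entropy relative to the tilted measure is `H(μ|ν) - ∫ f dμ + log ∫ exp f
  -- dν`, and it is nonnegative.
  have h3 := toReal_klDiv_of_measure_eq (hac.trans (absolutelyContinuous_tilted h1)) (by simp)
  rw [integral_llr_tilted_right hac hfμ h1 hint, ← toReal_klDiv_of_measure_eq hac (by simp)] at h3
  have h4 : 0 ≤ (klDiv μ (ν.tilted f)).toReal := ENNReal.toReal_nonneg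
  linarith

/-- Change of the reference measure of the relative entropy. -/
theorem klDiv_tilted_le (hf : Measurable f) (h1 : Integrable (fun x => Real.exp (f x)) ν)
    (h2 : Integrable (fun x => Real.exp (-f x)) ν) :
    klDiv μ (ν.tilted f) ≤ 2 * klDiv μ ν + ENNReal.ofReal
      (Real.log (∫ x, Real.exp (-f x) ∂ν) + Real.log (∫ x, Real.exp (f x) ∂ν)) := by
  by_cases h : klDiv μ ν = ⊤
  · simp [h]
  obtain ⟨hac, hint⟩ := klDiv_ne_top_iff.1 h
  have hfμ := integrable_of_klDiv_ne_top h hf h1 h2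
  have := isProbabilityMeasure_tilted h1
  have hac' := hac.trans (absolutelyContinuous_tilted h1)
  have hint' := integrable_llr_tilted_right hac hfμ hint h1
  have h3 := toReal_klDiv_of_measure_eq hac' (by simp)
  rw [integral_llr_tilted_right hac hfμ h1 hint, ← toReal_klDiv_of_measure_eq hac (by simp)] at h3
  -- The change of measure formula leaves `-∫ f dμ` to be bounded. The entropy inequality for `-f`
  -- does this at the price of a second copy of `H(μ|ν)`, hence the factor 2.
  have h4 := integral_le_klDiv_add_log (f := fun x => -f x) h hf.neg h2 (by simpa using h1)
  rw [integral_neg] at h4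
  rw [← ENNReal.ofReal_toReal (klDiv_ne_top hac' hint'), h3]
  calc _ ≤ ENNReal.ofReal (2 * (klDiv μ ν).toReal + (Real.log (∫ x, Real.exp (-f x) ∂ν) +
        Real.log (∫ x, Real.exp (f x) ∂ν))) := ENNReal.ofReal_le_ofReal (by linarith)
    _ ≤ _ := by
      refine ENNReal.ofReal_add_le.trans (add_le_add_left (le_of_eq ?_) _)
      rw [ENNReal.ofReal_mul (by norm_num), ENNReal.ofReal_toReal h]
      simp

end EntropyInequality

/-! ### Cameron–Martin shifts, cost of a change of mean, and concentration. -/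

section Tilting

theorem pi_withDensity {ι : Type*} [Fintype ι] {E : ι → Type*} [∀ i, MeasurableSpace (E i)]
    (μ : ∀ i, Measure (E i)) [∀ i, IsProbabilityMeasure (μ i)] (f : ∀ i, E i → ℝ≥0∞)
    (hf : ∀ i, Measurable (f i)) [∀ i, IsProbabilityMeasure ((μ i).withDensity (f i))] :
    Measure.pi (fun i => (μ i).withDensity (f i)) =
      (Measure.pi μ).withDensity fun x => ∏ i, f i (x i) := by
  classical
  refine (Measure.pi_eq fun s hs => ?_)
  rw [withDensity_apply _ (.univ_pi hs), ← lintegral_indicator (.univ_pi hs)]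
  have h : ∀ x : ∀ i, E i, (Set.univ.pi s).indicator (fun x => ∏ i, f i (x i)) x =
      ∏ i, (s i).indicator (f i) (x i) := by
    intro x
    by_cases hx : x ∈ Set.univ.pi s
    · rw [Set.indicator_of_mem hx]
      exact Finset.prod_congr rfl fun i _ => (Set.indicator_of_mem (hx i trivial) _).symm
    · rw [Set.indicator_of_notMem hx]
      simp only [Set.mem_pi, Set.mem_univ, true_imp_iff, not_forall] at hx
      obtain ⟨i, hi⟩ := hx
      exact (Finset.prod_eq_zero (Finset.mem_univ i) (Set.indicator_of_notMem hi _)).symm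
  simp only [h]
  have hm : ∀ i, Measurable ((s i).indicator (f i)) := fun i => (hf i).indicator (hs i)
  rw [lintegral_prod_eq_prod_lintegral_of_indepFun Finset.univ
    (fun i (x : ∀ i, E i) => (s i).indicator (f i) (x i))
    (iIndepFun_pi fun i => (hm i).aemeasurable) fun i => (hm i).comp (measurable_pi_apply i)]
  refine Finset.prod_congr rfl fun i _ => ?_
  refine ((measurePreserving_eval μ i).lintegral_comp (hm i)).trans ?_
  rw [lintegral_indicator (hs i), withDensity_apply _ (hs i)]

theorem gaussianReal_eq_withDensity (m m' : ℝ) {v : ℝ≥0} (hv : v ≠ 0) :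
    gaussianReal m' v = (gaussianReal m v).withDensity fun x =>
      ENNReal.ofReal (Real.exp ((m' - m) / v * (x - m) - (m' - m) ^ 2 / (2 * v))) := by
  rw [gaussianReal_of_var_ne_zero _ hv, gaussianReal_of_var_ne_zero _ hv,
    ← withDensity_mul _ (measurable_gaussianPDF _ _) (by fun_prop)]
  congr 1
  funext x
  have hv' : (v : ℝ) ≠ 0 := by exact_mod_cast hv
  simp only [Pi.mul_apply, gaussianPDF_def, gaussianPDFReal_def]
  rw [← ENNReal.ofReal_mul (by positivity), mul_assoc _ (Real.exp _), ← Real.exp_add]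
  congr 3
  field_simp
  ring

variable {N : ℕ}

/-- The quadratic form dual to `dualVar`. -/
noncomputable def energy (v w : ℝ≥0) (h : Config N) : ℝ :=
  ∑ x, ((h x).1 ^ 2 / v + (h x).2 ^ 2 / w)

/-- The linear functional `⟨d, ·⟩` for the scalar product whose quadratic form is `energy`. -/
noncomputable def energyDual (v w : ℝ≥0) (d : Config N) : StrongDual ℝ (Config N) :=
  ∑ x, (((d x).1 / v) • (ContinuousLinearMap.fst ℝ ℝ ℝ).comp (.proj x) +
    ((d x).2 / w) • (ContinuousLinearMap.snd ℝ ℝ ℝ).comp (.proj x))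

theorem energyDual_apply (v w : ℝ≥0) (d h : Config N) :
    energyDual v w d h = ∑ x, ((d x).1 / v * (h x).1 + (d x).2 / w * (h x).2) := by
  simp [energyDual]

theorem dualVar_energyDual {v w : ℝ≥0} (hv : v ≠ 0) (hw : w ≠ 0) (d : Config N) :
    dualVar v w (energyDual v w d) = energy v w d := by
  have hv' : (v : ℝ) ≠ 0 := by exact_mod_cast hv
  have hw' : (w : ℝ) ≠ 0 := by exact_mod_cast hw
  refine Finset.sum_congr rfl fun x _ => ?_
  have h1 : energyDual v w d (momentumUnit x) = (d x).1 / v := by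
    rw [energyDual_apply, Finset.sum_eq_single x]
    · simp [momentumUnit]
    · intro y _ hy
      simp [momentumUnit, hy]
    · simp
  have h2 : energyDual v w d (lengthUnit x) = (d x).2 / w := by
    rw [energyDual_apply, Finset.sum_eq_single x]
    · simp [lengthUnit]
    · intro y _ hy
      simp [lengthUnit, hy]
    · simp
  rw [h1, h2]
  field_simp

theorem integrable_exp_gaussProd (v w : ℝ≥0) (m : Config N) (L : StrongDual ℝ (Config N))
    (c : ℝ) : Integrable (fun h => Real.exp (L h - c)) (gaussProd v w m) := by
  have h := integrable_exp_mul_gaussianReal (μ := L m) (v := (dualVar v w L).toNNReal) 1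
  rw [← gaussProd_map_dual, integrable_map_measure (by fun_prop) (by fun_prop)] at h
  simp only [Real.exp_sub]
  simpa [Function.comp_def] using h.div_const (Real.exp c)

theorem integral_exp_gaussProd (v w : ℝ≥0) (m : Config N) (L : StrongDual ℝ (Config N)) (c : ℝ) :
    ∫ h, Real.exp (L h - c) ∂gaussProd v w m = Real.exp (L m - c + dualVar v w L / 2) := by
  have h := congrFun (mgf_id_gaussianReal (μ := L m) (v := (dualVar v w L).toNNReal)) 1
  rw [mgf, ← gaussProd_map_dual, integral_map (by fun_prop) (by fun_prop)] at h
  simp only [id_eq, one_mul, mul_one, one_pow, Real.coe_toNNReal _ (dualVar_nonneg v w L)] at h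
  simp only [Real.exp_sub]
  rw [integral_div, h, ← Real.exp_sub]
  congr 1
  ring

/-- The Cameron–Martin formula. The subtracted constant makes the integral of the exponential equal
to 1, so the tilting function is itself the log-density. -/
theorem gaussProd_eq_tilted {v w : ℝ≥0} (hv : v ≠ 0) (hw : w ≠ 0) (m m' : Config N) :
    gaussProd v w m' = (gaussProd v w m).tilted fun h => energyDual v w (m' - m) h -
      (energyDual v w (m' - m) m + energy v w (m' - m) / 2) := by
  rw [Measure.tilted, integral_exp_gaussProd, dualVar_energyDual hv hw]
  have h0 : ∀ x, (gaussianReal (m' x).1 v).prod (gaussianReal (m' x).2 w) =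
      ((gaussianReal (m x).1 v).prod (gaussianReal (m x).2 w)).withDensity fun z =>
        ENNReal.ofReal (Real.exp (((m' x).1 - (m x).1) / v * (z.1 - (m x).1)
          - ((m' x).1 - (m x).1) ^ 2 / (2 * v))) *
        ENNReal.ofReal (Real.exp (((m' x).2 - (m x).2) / w * (z.2 - (m x).2)
          - ((m' x).2 - (m x).2) ^ 2 / (2 * w))) := by
    intro x
    rw [gaussianReal_eq_withDensity (m x).1 (m' x).1 hv,
      gaussianReal_eq_withDensity (m x).2 (m' x).2 hw, prod_withDensity (by fun_prop) (by fun_prop)]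
  -- Rewritten below by `h0`, this supplies the probability instances for the factors with density
  -- that `pi_withDensity` requires.
  have h1 : ∀ x, IsProbabilityMeasure
      ((gaussianReal (m' x).1 v).prod (gaussianReal (m' x).2 w)) := fun x => inferInstance
  simp only [h0] at h1
  conv_lhs =>
    rw [gaussProd]
    enter [1, x]
    rw [h0]
  rw [pi_withDensity _ _ (fun x => by fun_prop)]
  unfold gaussProd
  congr 1
  funext h
  simp only [← ENNReal.ofReal_mul (Real.exp_pos _).le, ← Real.exp_add, ← Real.exp_sub]
  rw [← ENNReal.ofReal_prod_of_nonneg fun _ _ => (Real.exp_pos _).le, ← Real.exp_sum,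
    energyDual_apply, energyDual_apply, energy]
  congr 2
  have : ∀ a b c : ℝ, a - (b + c) - (b - (b + c) + c) = a - b - c := fun a b c => by ring
  rw [this, Finset.sum_div, ← Finset.sum_sub_distrib, ← Finset.sum_sub_distrib]
  refine Finset.sum_congr rfl fun x _ => ?_
  simp only [Pi.sub_apply, Prod.fst_sub, Prod.snd_sub]
  ring

/-- The cost of a change of the mean of the reference measure. -/
theorem klDiv_gaussProd_le {v w : ℝ≥0} (hv : v ≠ 0) (hw : w ≠ 0) (m m' : Config N)
    (μ : Measure (Config N)) [IsProbabilityMeasure μ] :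
    klDiv μ (gaussProd v w m') ≤
      2 * klDiv μ (gaussProd v w m) + ENNReal.ofReal (energy v w (m' - m)) := by
  have e : ∀ (c : ℝ) (h : Config N), -(energyDual v w (m' - m) h - c) =
      (-energyDual v w (m' - m)) h - -c := by
    intro c h
    simp
    ring
  have hneg : dualVar v w (-energyDual v w (m' - m)) = energy v w (m' - m) := by
    rw [← dualVar_energyDual hv hw]
    simp [dualVar]
  rw [gaussProd_eq_tilted hv hw m m']
  refine (klDiv_tilted_le (by fun_prop) (integrable_exp_gaussProd _ _ _ _ _) ?_).trans ?_
  · simp only [e]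
    exact integrable_exp_gaussProd _ _ _ _ _
  -- The linear terms and the constants of the two exponential moments cancel, and each contributes
  -- half of the energy of `m' - m`.
  · refine add_le_add_right (ENNReal.ofReal_le_ofReal (le_of_eq ?_)) _
    simp only [e]
    rw [integral_exp_gaussProd, integral_exp_gaussProd, hneg, dualVar_energyDual hv hw,
      Real.log_exp, Real.log_exp]
    simp

/-- A linear functional concentrates around its mean under `gaussProd v w m` up to the relative
entropy. -/
theorem measure_abs_sub_le {v w : ℝ≥0} (m : Config N) (L : StrongDual ℝ (Config N))
    (μ : Measure (Config N)) [IsProbabilityMeasure μ] (hkl : klDiv μ (gaussProd v w m) ≠ ⊤)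
    {lam ε : ℝ} (hlam : 0 < lam) (hε : 0 < ε) :
    μ {h | ε < |L h - L m|} ≤ ENNReal.ofReal (ε⁻¹ * (lam⁻¹ *
      ((klDiv μ (gaussProd v w m)).toReal + Real.log 2) + lam * dualVar v w L / 2)) := by
  have hq : ∀ c : ℝ, dualVar v w (c • L) = c ^ 2 * dualVar v w L := by
    intro c
    rw [dualVar, dualVar, Finset.mul_sum]
    refine Finset.sum_congr rfl fun x _ => ?_
    simp only [smul_apply, smul_eq_mul]
    ring
  have hint : ∀ c : ℝ, Integrable (fun h => Real.exp (c * (L h - L m))) (gaussProd v w m) := by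
    intro c
    have := integrable_exp_gaussProd v w m (c • L) (c * L m)
    simpa [mul_sub] using this
  have hexp : ∀ c : ℝ, ∫ h, Real.exp (c * (L h - L m)) ∂gaussProd v w m =
      Real.exp (c ^ 2 * dualVar v w L / 2) := by
    intro c
    have := integral_exp_gaussProd v w m (c • L) (c * L m)
    simpa [mul_sub, hq] using this
  have hle : ∀ h, Real.exp (lam * |L h - L m|) ≤
      Real.exp (lam * (L h - L m)) + Real.exp (-lam * (L h - L m)) := by
    intro h
    have := Real.exp_abs_le (lam * (L h - L m))
    rwa [abs_mul, abs_of_pos hlam, ← neg_mul] at this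
  have h1 : Integrable (fun h => Real.exp (lam * |L h - L m|)) (gaussProd v w m) :=
    ((hint lam).add (hint (-lam))).mono' (by fun_prop) (ae_of_all _ fun h => by
      rw [Real.norm_eq_abs, abs_of_pos (Real.exp_pos _)]; exact hle h)
  have h2 : Integrable (fun h => Real.exp (-(lam * |L h - L m|))) (gaussProd v w m) :=
    (integrable_const (1 : ℝ)).mono' (by fun_prop) (ae_of_all _ fun h => by
      rw [Real.norm_eq_abs, abs_of_pos (Real.exp_pos _), Real.exp_le_one_iff]
      have := abs_nonneg (L h - L m)
      nlinarith)
  have h3 := integral_le_klDiv_add_log hkl (by fun_prop) h1 h2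
  have h4 := integrable_of_klDiv_ne_top hkl (by fun_prop) h1 h2
  -- Bounding `exp |y|` by `exp y + exp (-y)` doubles the Gaussian exponential moment; this is the
  -- origin of `log 2`.
  have h5 : Real.log (∫ h, Real.exp (lam * |L h - L m|) ∂gaussProd v w m) ≤
      Real.log 2 + lam ^ 2 * dualVar v w L / 2 := by
    have : ∫ h, Real.exp (lam * |L h - L m|) ∂gaussProd v w m ≤
        2 * Real.exp (lam ^ 2 * dualVar v w L / 2) := by
      refine (integral_mono h1 ((hint lam).add (hint (-lam))) hle).trans (le_of_eq ?_)
      simp only [Pi.add_apply]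
      rw [integral_add (hint lam) (hint (-lam)), hexp, hexp, neg_sq]
      ring
    refine (Real.log_le_log (integral_exp_pos h1) this).trans (le_of_eq ?_)
    rw [Real.log_mul (by norm_num) (Real.exp_pos _).ne', Real.log_exp]
  have hsub : {h | ε < |L h - L m|} ⊆ {h | lam * ε ≤ lam * |L h - L m|} := fun h hh =>
    mul_le_mul_of_nonneg_left (le_of_lt hh) hlam.le
  -- Markov's inequality for `lam |L - L m|` under `μ`, whose mean is controlled by the entropy
  -- inequality. The parameter `lam` stays free, to be optimised later.
  have h6 := mul_meas_ge_le_integral_of_nonneg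
    (ae_of_all μ fun h => mul_nonneg hlam.le (abs_nonneg (L h - L m))) h4 (lam * ε)
  refine (measure_mono hsub).trans ?_
  rw [← ENNReal.ofReal_toReal (measure_ne_top μ _)]
  refine ENNReal.ofReal_le_ofReal ?_
  rw [measureReal_def] at h6
  have h7 := h6.trans (h3.trans (add_le_add_right h5 _))
  rw [mul_comm, ← le_div_iff₀ (by positivity)] at h7
  refine h7.trans (le_of_eq ?_)
  field_simp
  ring

end Tilting

/-! ### Riemann sums along uniform partitions. -/

section RiemannSums

variable {E : Type*} [NormedAddCommGroup E]

theorem partition_le {t : ℝ} (ht : 0 ≤ t) {n : ℕ} (j : ℕ) :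
    (j : ℝ) * t / n ≤ ((j + 1 : ℕ) : ℝ) * t / n := by
  gcongr
  simp

theorem partition_mem {t : ℝ} (ht : 0 ≤ t) {n j : ℕ} (hn : 0 < n) (hj : j ≤ n) :
    (j : ℝ) * t / n ∈ Set.Icc 0 t := by
  have hn' : (0 : ℝ) < n := by exact_mod_cast hn
  have hj' : (j : ℝ) ≤ n := by exact_mod_cast hj
  refine ⟨by positivity, ?_⟩
  rw [div_le_iff₀ hn', mul_comm t]
  gcongr

theorem partition_sub (t : ℝ) {n : ℕ} (j : ℕ) :
    ((j + 1 : ℕ) : ℝ) * t / n - (j : ℝ) * t / n = t / n := by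
  push_cast
  ring

/-- A function of intervals that is `o(b - a)` uniformly has vanishing sums along partitions. -/
theorem tendsto_sum_partition_zero {t : ℝ} (ht : 0 ≤ t) (g : ℝ → ℝ → E)
    (hg : ∀ ε > 0, ∃ δ > 0, ∀ a ∈ Set.Icc 0 t, ∀ b ∈ Set.Icc 0 t, a ≤ b → b - a < δ →
      ‖g a b‖ ≤ ε * (b - a)) :
    Tendsto (fun n : ℕ => ∑ j ∈ Finset.range n, g (j * t / n) ((j + 1 : ℕ) * t / n)) atTop
      (𝓝 0) := by
  rw [Metric.tendsto_atTop]
  intro ε hε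
  obtain ⟨δ, hδ, h⟩ := hg (ε / (t + 1)) (by positivity)
  have hlim : Tendsto (fun n : ℕ => t / n) atTop (𝓝 0) := tendsto_const_div_atTop_nhds_zero_nat t
  obtain ⟨n₀, hn₀⟩ := eventually_atTop.1 (hlim.eventually (gt_mem_nhds hδ))
  refine ⟨n₀ + 1, fun n hn => ?_⟩
  have hn1 : 0 < n := by omega
  have hn' : (n : ℝ) ≠ 0 := by exact_mod_cast hn1.ne'
  rw [dist_zero_right]
  have hb : ∀ j ∈ Finset.range n, ‖g (j * t / n) ((j + 1 : ℕ) * t / n)‖ ≤ ε / (t + 1) * (t / n) := by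
    intro j hj
    have hj' := Finset.mem_range.1 hj
    rw [← partition_sub t j]
    refine h _ (partition_mem ht hn1 hj'.le) _ (partition_mem ht hn1 hj') (partition_le ht j) ?_
    rw [partition_sub]
    exact hn₀ n (by omega)
  calc _ ≤ ∑ j ∈ Finset.range n, ε / (t + 1) * (t / n) := norm_sum_le_of_le _ hb
    _ = ε * (t / (t + 1)) := by
      rw [Finset.sum_const, Finset.card_range, nsmul_eq_mul]
      field_simp
    _ < ε := by
      have : t / (t + 1) < 1 := by rw [div_lt_one (by positivity)]; linarith
      nlinarith

theorem intervalIntegrable_of_mem {t a b : ℝ} {f : ℝ → E} (hf : ContinuousOn f (Set.Icc 0 t))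
    (ha : a ∈ Set.Icc 0 t) (hb : b ∈ Set.Icc 0 t) : IntervalIntegrable f volume a b :=
  (hf.mono (Set.uIcc_subset_Icc ha hb)).intervalIntegrable

variable [NormedSpace ℝ E]

theorem sum_integral_partition {t : ℝ} (ht : 0 ≤ t) {f : ℝ → E}
    (hf : ContinuousOn f (Set.Icc 0 t)) {n : ℕ} (hn : 0 < n) :
    ∑ j ∈ Finset.range n, ∫ s in (j * t / n : ℝ)..((j + 1 : ℕ) * t / n), f s =
      ∫ s in (0 : ℝ)..t, f s := by
  have hn' : (n : ℝ) ≠ 0 := by exact_mod_cast hn.ne'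
  rw [intervalIntegral.sum_integral_adjacent_intervals (a := fun j : ℕ => (j : ℝ) * t / n)
    fun k hk => intervalIntegrable_of_mem hf (partition_mem ht hn hk.le) (partition_mem ht hn hk)]
  simp [mul_div_cancel_left₀ t hn']

theorem tendsto_riemann_sum {t : ℝ} (ht : 0 ≤ t) {f : ℝ → ℝ} (hf : ContinuousOn f (Set.Icc 0 t)) :
    Tendsto (fun n : ℕ => ∑ j ∈ Finset.range n,
      f (j * t / n) * (((j + 1 : ℕ) : ℝ) * t / n - j * t / n)) atTop
      (𝓝 (∫ s in (0 : ℝ)..t, f s)) := by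
  have h := tendsto_sum_partition_zero ht (fun a b => f a * (b - a) - ∫ s in a..b, f s) ?_
  · have h' := h.add_const (∫ s in (0 : ℝ)..t, f s)
    rw [zero_add] at h'
    refine h'.congr' ?_
    filter_upwards [eventually_gt_atTop 0] with n hn
    rw [Finset.sum_sub_distrib, sum_integral_partition ht hf hn]
    ring
  · intro ε hε
    obtain ⟨δ, hδ, hu⟩ := Metric.uniformContinuousOn_iff.1
      (isCompact_Icc.uniformContinuousOn_of_continuous hf) ε hε
    refine ⟨δ, hδ, fun a ha b hb hab hlt => ?_⟩
    have e : f a * (b - a) - ∫ s in a..b, f s = ∫ s in a..b, (f a - f s) := by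
      rw [intervalIntegral.integral_sub intervalIntegrable_const
        (intervalIntegrable_of_mem hf ha hb), intervalIntegral.integral_const, smul_eq_mul, mul_comm]
    rw [e, ← abs_of_nonneg (sub_nonneg.2 hab)]
    refine intervalIntegral.norm_integral_le_of_norm_le_const fun s hs => ?_
    rw [Set.uIoc_of_le hab] at hs
    refine (hu a ha s ⟨ha.1.trans hs.1.le, hs.2.trans hb.2⟩ ?_).le
    rw [Real.dist_eq, abs_sub_comm, abs_of_nonneg (by linarith [hs.1])]
    linarith [hs.2]

end RiemannSums

/-! ### Pathwise variation of constants. -/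

section LinearEquation

variable {E : Type*} [NormedAddCommGroup E] [NormedSpace ℝ E] [CompleteSpace E]

theorem hasDerivAt_exp_sub_smul_apply (A : E →L[ℝ] E) (t s : ℝ) (y : E) :
    HasDerivAt (fun s => NormedSpace.exp ((t - s) • A) y)
      (-(NormedSpace.exp ((t - s) • A) (A y))) s := by
  have h := (hasDerivAt_exp_smul_const A (t - s)).scomp s ((hasDerivAt_id s).const_sub t)
  have h' := h.clm_apply (hasDerivAt_const s y)
  simpa using h'

theorem continuous_exp_sub_smul (A : E →L[ℝ] E) (t : ℝ) :
    Continuous fun s : ℝ => NormedSpace.exp ((t - s) • A) :=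
  (continuous_iff_continuousAt.2 fun s =>
    (hasDerivAt_exp_smul_const (𝕂 := ℝ) A s).continuousAt).comp (continuous_const.sub continuous_id)

/-- Variation of constants for a linear equation with a merely continuous forcing, the stochastic
convolution being the limit of its Riemann sums. -/
theorem tendsto_sum_exp_increment (A : E →L[ℝ] E) {X M : ℝ → E} {t : ℝ} (ht : 0 ≤ t)
    (hX : ContinuousOn X (Set.Icc 0 t))
    (hM : ∀ s ∈ Set.Icc 0 t, X s = X 0 + (∫ r in (0 : ℝ)..s, A (X r)) + M s) :
    Tendsto (fun n : ℕ => ∑ j ∈ Finset.range n, NormedSpace.exp ((t - j * t / n) • A)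
      (M ((j + 1 : ℕ) * t / n) - M (j * t / n))) atTop
      (𝓝 (X t - NormedSpace.exp (t • A) (X 0))) := by
  set U : ℝ → E →L[ℝ] E := fun s => NormedSpace.exp ((t - s) • A) with hU
  have hUc : Continuous U := continuous_exp_sub_smul A t
  have hAX : ContinuousOn (fun s => A (X s)) (Set.Icc 0 t) := A.continuous.comp_continuousOn hX
  have hG : ContinuousOn (fun z : ℝ × ℝ => U z.1 (A (X z.2))) (Set.Icc 0 t ×ˢ Set.Icc 0 t) :=
    (hUc.comp continuous_fst).continuousOn.clm_apply
      (hAX.comp continuous_snd.continuousOn fun z hz => hz.2)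
  -- The increments of `s ↦ U s (X s)` telescope to `X t - exp (t A) (X 0)`, so it is enough that
  -- they differ from `U a (M b - M a)` by `o(b - a)`. Only continuity of `X` is needed for this.
  have h := tendsto_sum_partition_zero ht (fun a b => U a (M b - M a) - (U b (X b) - U a (X a))) ?_
  · have h' := h.add_const (X t - NormedSpace.exp (t • A) (X 0))
    rw [zero_add] at h'
    refine h'.congr' ?_
    filter_upwards [eventually_gt_atTop 0] with n hn
    have hn' : (n : ℝ) ≠ 0 := by exact_mod_cast hn.ne'
    rw [Finset.sum_sub_distrib,
      Finset.sum_range_sub (fun j : ℕ => U ((j : ℝ) * t / n) (X ((j : ℝ) * t / n)))]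
    simp [hU, mul_div_cancel_left₀ t hn']
  · intro ε hε
    obtain ⟨δ, hδ, hu⟩ := Metric.uniformContinuousOn_iff.1
      ((isCompact_Icc.prod isCompact_Icc).uniformContinuousOn_of_continuous hG) ε hε
    refine ⟨δ, hδ, fun a ha b hb hab hlt => ?_⟩
    have h1 : U a (M b - M a) = U a (X b) - U a (X a) - ∫ s in a..b, U a (A (X s)) := by
      rw [(U a).intervalIntegral_comp_comm (intervalIntegrable_of_mem hAX ha hb),
        ← intervalIntegral.integral_interval_sub_left
          (intervalIntegrable_of_mem hAX ⟨le_rfl, ht⟩ hb)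
          (intervalIntegrable_of_mem hAX ⟨le_rfl, ht⟩ ha), ← map_sub, ← map_sub]
      congr 1
      have hb' := hM b hb
      have ha' := hM a ha
      rw [← sub_eq_iff_eq_add'] at hb' ha'
      rw [← hb', ← ha']
      abel
    have h2 : U b (X b) - U a (X b) = ∫ s in a..b, -(U s (A (X b))) := by
      refine (intervalIntegral.integral_eq_sub_of_hasDerivAt (fun s _ =>
        hasDerivAt_exp_sub_smul_apply A t s (X b)) ?_).symm
      exact (hUc.clm_apply continuous_const).neg.intervalIntegrable _ _
    have hi1 : IntervalIntegrable (fun s => U a (A (X s))) volume a b :=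
      intervalIntegrable_of_mem ((U a).continuous.comp_continuousOn hAX) ha hb
    have hi2 : IntervalIntegrable (fun s => U s (A (X b))) volume a b :=
      (hUc.clm_apply continuous_const).intervalIntegrable _ _
    -- The integrand is a difference of two values of `(s, r) ↦ U s (A (X r))`, at the points `(s,
    -- b)` and `(a, s)`. Both coordinates of these points differ by at most `b - a`, so uniform
    -- continuity applies.
    have e : U a (M b - M a) - (U b (X b) - U a (X a)) =
        ∫ s in a..b, (U s (A (X b)) - U a (A (X s))) := by
      rw [intervalIntegral.integral_sub hi2 hi1, h1]
      rw [intervalIntegral.integral_neg, eq_neg_iff_add_eq_zero, add_comm] at h2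
      have h3 := eq_neg_of_add_eq_zero_left h2
      rw [h3]
      abel
    rw [e, ← abs_of_nonneg (sub_nonneg.2 hab)]
    refine intervalIntegral.norm_integral_le_of_norm_le_const fun s hs => ?_
    rw [Set.uIoc_of_le hab] at hs
    have hs' : s ∈ Set.Icc 0 t := ⟨ha.1.trans hs.1.le, hs.2.trans hb.2⟩
    rw [← dist_eq_norm]
    refine (hu (s, b) ⟨hs', hb⟩ (a, s) ⟨ha, hs'⟩ ?_).le
    rw [Prod.dist_eq, max_lt_iff, Real.dist_eq, Real.dist_eq, abs_of_nonneg (by linarith [hs.1]),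
      abs_of_nonneg (by linarith [hs.2])]
    exact ⟨by linarith [hs.2], by linarith [hs.1]⟩

end LinearEquation

/-! ### Characteristic functions of Brownian step integrals. -/

section Noise

variable {Ω : Type*} [MeasurableSpace Ω] {P : Measure Ω}

theorem integral_exp_increment {B : ℝ≥0 → Ω → ℝ} (hB : IsPreBrownianReal B P) {s t : ℝ≥0}
    (hst : s ≤ t) (c : ℝ) :
    ∫ ω, Complex.exp ((c * (B t ω - B s ω) : ℝ) * Complex.I) ∂P =
      Complex.exp (-(c ^ 2 * (t - s) : ℝ) / 2) := by
  have hl := hB.hasLaw_sub t s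
  have h := charFun_gaussianReal (μ := 0) (v := nndist t.1 s.1) c
  rw [← hl.map_eq, charFun_apply_real, integral_map hl.aemeasurable (by fun_prop)] at h
  have hd : ((nndist t.1 s.1 : ℝ≥0) : ℝ) = t - s := by
    rw [coe_nndist, Real.dist_eq]
    exact abs_of_nonneg (sub_nonneg.2 (NNReal.coe_le_coe.2 hst))
  rw [hd] at h
  simp only [Pi.sub_apply] at h
  push_cast at h ⊢
  rw [h]
  ring_nf

theorem integral_exp_sum_increments {B : ℝ≥0 → Ω → ℝ} (hB : IsPreBrownianReal B P)
    {τ : ℕ → ℝ≥0} (hτ : Monotone τ) (c : ℕ → ℝ) (n : ℕ) :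
    ∫ ω, Complex.exp ((∑ j ∈ Finset.range n, c j * (B (τ (j + 1)) ω - B (τ j) ω) : ℝ) *
        Complex.I) ∂P =
      Complex.exp (-(∑ j ∈ Finset.range n, c j ^ 2 * (τ (j + 1) - τ j) : ℝ) / 2) := by
  have hi := (hB.hasIndepIncrements.nat hτ).precomp (Fin.val_injective (n := n))
  have h := hi.integral_fun_prod_comp
    (f := fun (j : Fin n) y => Complex.exp ((c j * y : ℝ) * Complex.I))
    (fun j => (hB.aemeasurable _).sub (hB.aemeasurable _)) (fun j => by fun_prop)
  have h1 : ∀ j : Fin n, _ := fun j =>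
    integral_exp_increment hB (hτ (Nat.le_succ (j : ℕ))) (c j)
  simp only [Nat.succ_eq_add_one] at h1
  simp only [h1, ← Complex.exp_sum] at h
  simp only [Finset.sum_range]
  push_cast at h ⊢
  rw [neg_div, Finset.sum_div, ← Finset.sum_neg_distrib]
  simp only [Finset.sum_mul, ← neg_div]
  exact h

/-- Independence of the motions factors the expectation over `x`, and independence of increments
factors it over `j`. This is the Gaussian law of the Riemann sums that approximate the stochastic
convolution. -/
theorem integral_exp_sum_sum_increments {ι : Type*} [Fintype ι] {B : ι → ℝ≥0 → Ω → ℝ}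
    (hB : ∀ x, IsPreBrownianReal (B x) P) (hm : ∀ x t, Measurable (B x t))
    (hind : iIndepFun (fun x (ω : Ω) (t : ℝ≥0) => B x t ω) P)
    {τ : ℕ → ℝ≥0} (hτ : Monotone τ) (c : ι → ℕ → ℝ) (n : ℕ) :
    ∫ ω, Complex.exp ((∑ x, ∑ j ∈ Finset.range n, c x j * (B x (τ (j + 1)) ω - B x (τ j) ω) : ℝ) *
        Complex.I) ∂P =
      Complex.exp (-(∑ x, ∑ j ∈ Finset.range n, c x j ^ 2 * (τ (j + 1) - τ j) : ℝ) / 2) := by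
  have h := hind.integral_fun_prod_comp
    (f := fun x b => Complex.exp ((∑ j ∈ Finset.range n, c x j * (b (τ (j + 1)) - b (τ j)) : ℝ) *
        Complex.I))
    (fun x => (measurable_pi_lambda _ fun t => hm x t).aemeasurable) (fun x => by
      refine Measurable.aestronglyMeasurable ?_
      fun_prop)
  have h1 : ∀ x, _ := fun x => integral_exp_sum_increments (hB x) hτ (c x) n
  simp only [h1, ← Complex.exp_sum] at h
  push_cast at h ⊢
  rw [neg_div, Finset.sum_div, ← Finset.sum_neg_distrib]
  simp only [Finset.sum_mul, ← neg_div] at h ⊢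
  exact h

variable [IsProbabilityMeasure P]

/-- The characteristic function of a pair of an initial state and of a limit of functions of an
independent noise. -/
theorem integral_exp_mul_exp_of_tendsto {F F' : Type*} [MeasurableSpace F] [MeasurableSpace F']
    {X : Ω → F} {Y : Ω → F'} (hX : Measurable X) (hY : Measurable Y) (hXY : IndepFun X Y P)
    {f : F → ℝ} (hf : Measurable f) {S : ℕ → F' → ℝ} (hS : ∀ n, Measurable (S n)) {Z : Ω → ℝ}
    (hlim : ∀ᵐ ω ∂P, Tendsto (fun n => S n (Y ω)) atTop (𝓝 (Z ω))) {v : ℕ → ℝ} {v' : ℝ}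
    (hv : Tendsto v atTop (𝓝 v'))
    (hint : ∀ n, ∫ ω, Complex.exp (S n (Y ω) * Complex.I) ∂P = Complex.exp (-(v n : ℝ) / 2)) :
    ∫ ω, Complex.exp (f (X ω) * Complex.I) * Complex.exp (Z ω * Complex.I) ∂P =
      (∫ ω, Complex.exp (f (X ω) * Complex.I) ∂P) * Complex.exp (-(v' : ℝ) / 2) := by
  -- `Z` is only an almost sure limit and is not given as a function of `Y`. Independence is
  -- therefore used for `S n ∘ Y` and carried to the limit by dominated convergence, the integrands
  -- having modulus 1.
  have hl : Tendsto (fun n => ∫ ω, Complex.exp (f (X ω) * Complex.I) *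
      Complex.exp (S n (Y ω) * Complex.I) ∂P) atTop
      (𝓝 (∫ ω, Complex.exp (f (X ω) * Complex.I) * Complex.exp (Z ω * Complex.I) ∂P)) := by
    refine tendsto_integral_of_dominated_convergence (fun _ => (1 : ℝ)) (fun n => ?_)
      (integrable_const _) (fun n => ae_of_all _ fun ω => ?_) ?_
    · have h1 : Measurable fun ω => S n (Y ω) := (hS n).comp hY
      have h2 : Measurable fun ω => f (X ω) := hf.comp hX
      exact Measurable.aestronglyMeasurable (by fun_prop)
    · rw [norm_mul, Complex.norm_exp_ofReal_mul_I, Complex.norm_exp_ofReal_mul_I, mul_one]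
    · filter_upwards [hlim] with ω hω
      refine Tendsto.const_mul _ ?_
      exact ((Complex.continuous_exp.comp (Complex.continuous_ofReal.mul
        continuous_const)).tendsto _).comp hω
  refine tendsto_nhds_unique hl ?_
  have hprod : ∀ n, ∫ ω, Complex.exp (f (X ω) * Complex.I) *
      Complex.exp (S n (Y ω) * Complex.I) ∂P =
      (∫ ω, Complex.exp (f (X ω) * Complex.I) ∂P) * Complex.exp (-(v n : ℝ) / 2) := by
    intro n
    have hn := hS n
    have h := hXY.integral_fun_comp_mul_comp
      (f := fun y => Complex.exp (f y * Complex.I))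
      (g := fun b => Complex.exp (S n b * Complex.I)) hX.aemeasurable hY.aemeasurable
      (Measurable.aestronglyMeasurable (by fun_prop))
      (Measurable.aestronglyMeasurable (by fun_prop))
    rw [h, hint]
  simp only [hprod]
  refine Tendsto.const_mul _ ((Complex.continuous_exp.tendsto _).comp ?_)
  exact ((((Complex.continuous_ofReal.tendsto _).comp hv).neg).div_const _)

end Noise

/-! ### The law of a linear equation with additive Brownian noise. -/

section LinearEquation

variable {Ω : Type*} [MeasurableSpace Ω] {P : Measure Ω} [IsProbabilityMeasure P]
  {E : Type*} [NormedAddCommGroup E] [NormedSpace ℝ E] [CompleteSpace E] [MeasurableSpace E]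
  [BorelSpace E] [SecondCountableTopology E] {ι : Type*} [Fintype ι]

/-- The law at time `t` of the solution of a linear equation with additive Brownian noise is the
law of the sum of the transported initial state and of an independent Gaussian vector. -/
theorem exists_map_eq_prod_map (A : E →L[ℝ] E) (q : ι → E) {B : ι → ℝ≥0 → Ω → ℝ}
    (hB : ∀ x, IsPreBrownianReal (B x) P) (hm : ∀ x t, Measurable (B x t))
    (hind : iIndepFun (fun x (ω : Ω) (t : ℝ≥0) => B x t ω) P) {X : ℝ → Ω → E}
    (hX : ∀ t, Measurable (X t)) (hXc : ∀ᵐ ω ∂P, ContinuousOn (fun t => X t ω) (Set.Ici 0))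
    (hX0 : IndepFun (X 0) (fun (ω : Ω) (x : ι) (t : ℝ≥0) => B x t ω) P)
    (heq : ∀ᵐ ω ∂P, ∀ s, 0 ≤ s → X s ω = X 0 ω + (∫ r in (0 : ℝ)..s, A (X r ω)) +
      ∑ x, B x s.toNNReal ω • q x) {t : ℝ} (ht : 0 ≤ t) :
    ∃ ρ : Measure E, IsProbabilityMeasure ρ ∧
      (∀ L : StrongDual ℝ E, charFunDual ρ L = Complex.exp (-(∫ s in (0 : ℝ)..t,
        ∑ x, L (NormedSpace.exp ((t - s) • A) (q x)) ^ 2 : ℝ) / 2)) ∧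
      P.map (X t) = ((P.map (X 0)).prod ρ).map fun z => NormedSpace.exp (t • A) z.1 + z.2 := by
  set U : ℝ → E →L[ℝ] E := fun s => NormedSpace.exp ((t - s) • A) with hU
  have hUc : Continuous U := continuous_exp_sub_smul A t
  -- `W` is the stochastic convolution. Its law is the required `ρ`, and its independence of `X 0`
  -- is read off from the factorised joint characteristic function `hjoint`.
  set W : Ω → E := fun ω => X t ω - NormedSpace.exp (t • A) (X 0 ω) with hW
  have hWm : Measurable W := (hX t).sub ((ContinuousLinearMap.measurable _).comp (hX 0))
  set τ : ℕ → ℕ → ℝ≥0 := fun n j => ((j : ℝ) * t / n).toNNReal with hτdef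
  have hτ : ∀ n, Monotone (τ n) := fun n => monotone_nat_of_le_succ fun j =>
    Real.toNNReal_le_toNNReal (partition_le ht j)
  have hτc : ∀ n j, ((τ n j : ℝ≥0) : ℝ) = j * t / n := fun n j =>
    Real.coe_toNNReal _ (by positivity)
  set c : StrongDual ℝ E → ℕ → ι → ℕ → ℝ := fun L n x j => L (U (j * t / n) (q x)) with hc
  set S : StrongDual ℝ E → ℕ → (ι → ℝ≥0 → ℝ) → ℝ := fun L n b =>
    ∑ x, ∑ j ∈ Finset.range n, c L n x j * (b x (τ n (j + 1)) - b x (τ n j)) with hS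
  set V : StrongDual ℝ E → ℝ := fun L => ∫ s in (0 : ℝ)..t, ∑ x, L (U s (q x)) ^ 2 with hV
  have hlim : ∀ L : StrongDual ℝ E, ∀ᵐ ω ∂P,
      Tendsto (fun n => S L n fun x t => B x t ω) atTop (𝓝 (L (W ω))) := by
    intro L
    filter_upwards [hXc, heq] with ω h1 h2
    have h := tendsto_sum_exp_increment A ht (X := fun s => X s ω)
      (M := fun s => ∑ x, B x s.toNNReal ω • q x) (h1.mono Set.Icc_subset_Ici_self)
      fun s hs => h2 s hs.1
    refine ((L.continuous.tendsto _).comp h).congr fun n => ?_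
    simp only [Function.comp_apply, map_sum, hS, hc, hτdef]
    rw [Finset.sum_comm]
    refine Finset.sum_congr rfl fun j _ => ?_
    rw [← Finset.sum_sub_distrib, map_sum, map_sum]
    refine Finset.sum_congr rfl fun x _ => ?_
    rw [← sub_smul, map_smul, map_smul, smul_eq_mul, mul_comm]
  have hvar : ∀ L : StrongDual ℝ E, Tendsto (fun n => ∑ x, ∑ j ∈ Finset.range n,
      c L n x j ^ 2 * ((τ n (j + 1) : ℝ) - τ n j)) atTop (𝓝 (V L)) := by
    intro L
    have h := tendsto_riemann_sum ht (f := fun s => ∑ x, L (U s (q x)) ^ 2) (by fun_prop)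
    refine h.congr fun n => ?_
    rw [Finset.sum_comm]
    refine Finset.sum_congr rfl fun j _ => ?_
    rw [hτc, hτc, Finset.sum_mul]
  have hjoint : ∀ L₁ L₂ : StrongDual ℝ E,
      ∫ ω, Complex.exp (L₁ (X 0 ω) * Complex.I) * Complex.exp (L₂ (W ω) * Complex.I) ∂P =
        charFunDual (P.map (X 0)) L₁ * Complex.exp (-(V L₂ : ℝ) / 2) := by
    intro L₁ L₂
    have hY : Measurable fun (ω : Ω) (x : ι) (t : ℝ≥0) => B x t ω :=
      measurable_pi_lambda _ fun x => measurable_pi_lambda _ fun t => hm x t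
    rw [charFunDual_apply, integral_map (hX 0).aemeasurable
      (Measurable.aestronglyMeasurable (by fun_prop))]
    refine integral_exp_mul_exp_of_tendsto (hX 0) hY hX0 L₁.measurable (fun n => ?_) (hlim L₂)
      (hvar L₂) fun n => integral_exp_sum_sum_increments hB hm hind (hτ n) _ n
    refine Finset.measurable_sum _ fun x _ => Finset.measurable_sum _ fun j _ => ?_
    refine Measurable.const_mul (Measurable.sub ?_ ?_) _
    · exact (measurable_pi_apply (τ n (j + 1))).comp (measurable_pi_apply x)
    · exact (measurable_pi_apply (τ n j)).comp (measurable_pi_apply x)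
  have hcharW : ∀ L, charFunDual (P.map W) L = Complex.exp (-(V L : ℝ) / 2) := by
    intro L
    -- With the zero functional on the initial state the joint formula reduces to the characteristic
    -- function of `W`.
    have := hjoint 0 L
    rw [charFunDual_apply, integral_map hWm.aemeasurable
      (Measurable.aestronglyMeasurable (by fun_prop))]
    have hp : IsProbabilityMeasure (P.map (X 0)) :=
      Measure.isProbabilityMeasure_map (hX 0).aemeasurable
    simpa [charFunDual_apply] using this
  have hindW : IndepFun (X 0) W P := by
    rw [indepFun_iff_charFunDual_prod (hX 0).aemeasurable hWm.aemeasurable]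
    intro L
    rw [hcharW, ← hjoint, charFunDual_apply,
      integral_map ((hX 0).prodMk hWm).aemeasurable
      (Measurable.aestronglyMeasurable (by fun_prop))]
    congr 1
    funext ω
    rw [← Complex.exp_add, ← add_mul]
    congr 2
    have := L.comp_inl_add_comp_inr (X 0 ω, W ω)
    rw [← this]
    push_cast
    rfl
  refine ⟨P.map W, Measure.isProbabilityMeasure_map hWm.aemeasurable, hcharW, ?_⟩
  rw [← (indepFun_iff_map_prod_eq_prod_map_map (hX 0).aemeasurable hWm.aemeasurable).1 hindW,
    Measure.map_map (by fun_prop) ((hX 0).prodMk hWm)]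
  congr 1
  funext ω
  simp [hW]

end LinearEquation

/-! ### The linear drift, the noise directions and the Lyapunov equation. -/

section Drift

variable {N : ℕ}

theorem succ_pred (x : Fin N) : succ (pred x) = x := Equiv.apply_symm_apply _ _

theorem pred_succ (x : Fin N) : pred (succ x) = x := Equiv.symm_apply_apply _ _

theorem sum_succ (f : Fin N → ℝ) : ∑ x, f (succ x) = ∑ x, f x := Equiv.sum_comp (finRotate N) f

theorem eq_succ_iff {x y : Fin N} : y = succ x ↔ pred y = x :=
  (Equiv.symm_apply_eq (finRotate N)).symm

theorem eq_pred_iff {x y : Fin N} : y = pred x ↔ succ y = x :=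
  (Equiv.eq_symm_apply (finRotate N))

/-- The momentum at `x`. -/
def momentumProj (x : Fin N) : StrongDual ℝ (Config N) :=
  (ContinuousLinearMap.fst ℝ ℝ ℝ).comp (.proj x)

/-- The length at `x`. -/
def lengthProj (x : Fin N) : StrongDual ℝ (Config N) :=
  (ContinuousLinearMap.snd ℝ ℝ ℝ).comp (.proj x)

@[simp] theorem momentumProj_apply (x : Fin N) (h : Config N) : momentumProj x h = (h x).1 := rfl

@[simp] theorem lengthProj_apply (x : Fin N) (h : Config N) : lengthProj x h = (h x).2 := rfl

/-- The drift of the harmonic chain with potential `k r ^ 2`. -/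
def drift (N : ℕ) (β k γ a : ℝ) : Config N →L[ℝ] Config N :=
  ContinuousLinearMap.pi fun x =>
    ((a * (2 * k)) • (lengthProj (succ x) - lengthProj x)).prod
      (a • (momentumProj x - momentumProj (pred x) + (β * γ * k) •
        (lengthProj (succ x) + lengthProj (pred x) - (2 : ℝ) • lengthProj x)))

variable (β k γ a : ℝ)

theorem drift_apply (h : Config N) (x : Fin N) :
    drift N β k γ a h x = (a * (2 * k) * ((h (succ x)).2 - (h x).2),
      a * ((h x).1 - (h (pred x)).1 +
        β * γ * k * ((h (succ x)).2 + (h (pred x)).2 - 2 * (h x).2))) := rfl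

/-- The direction in which the noise of the bond between `x` and `x + 1` acts. -/
noncomputable def noiseDir (γ a : ℝ) (x : Fin N) : Config N :=
  √(a * γ) • (lengthUnit (succ x) - lengthUnit x)

theorem momentumUnit_apply (x y : Fin N) :
    momentumUnit x y = (if y = x then 1 else 0, 0) := by
  rw [momentumUnit, Pi.single_apply]
  split_ifs <;> rfl

theorem lengthUnit_apply (x y : Fin N) :
    lengthUnit x y = (0, if y = x then 1 else 0) := by
  rw [lengthUnit, Pi.single_apply]
  split_ifs <;> rfl

theorem drift_momentumUnit (x : Fin N) :
    drift N β k γ a (momentumUnit x) = a • (lengthUnit x - lengthUnit (succ x)) := by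
  funext y
  simp only [drift_apply, Pi.smul_apply, Pi.sub_apply, momentumUnit_apply, lengthUnit_apply,
    eq_succ_iff, Prod.mk_sub_mk, Prod.smul_mk, smul_eq_mul]
  simp

theorem drift_lengthUnit (x : Fin N) :
    drift N β k γ a (lengthUnit x) =
      (a * (2 * k)) • (momentumUnit (pred x) - momentumUnit x) +
        (a * (β * γ * k)) •
          (lengthUnit (succ x) + lengthUnit (pred x) - (2 : ℝ) • lengthUnit x) := by
  funext y
  simp only [drift_apply, Pi.smul_apply, Pi.sub_apply, Pi.add_apply, momentumUnit_apply,
    lengthUnit_apply, eq_succ_iff, eq_pred_iff, Prod.mk_sub_mk, Prod.smul_mk, smul_eq_mul,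
    Prod.mk_add_mk]
  simp
  ring

variable {β k γ a}

/-- The Lyapunov equation: the Gibbs measures are stationary. -/
theorem sum_drift_eq_sum_noiseDir (hβ : 0 < β) (hk : 0 < k) (hγ : 0 ≤ γ) (ha : 0 ≤ a)
    (M : StrongDual ℝ (Config N)) :
    ∑ x, ((β⁻¹).toNNReal * (2 * M (momentumUnit x) * -M (drift N β k γ a (momentumUnit x))) +
      ((2 * k * β)⁻¹).toNNReal * (2 * M (lengthUnit x) * -M (drift N β k γ a (lengthUnit x)))) =
    ∑ x, M (noiseDir γ a x) ^ 2 := by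
  rw [Real.coe_toNNReal _ (by positivity), Real.coe_toNNReal _ (by positivity)]
  -- A shift of the summation index cancels the Hamiltonian cross terms, whose coefficients match
  -- because the variances are `β⁻¹` and `(2 k β)⁻¹`. The dissipative terms that remain add up to
  -- the squares coming from the noise.
  have h1 : ∑ x : Fin N, M (momentumUnit (pred x)) * M (lengthUnit x) =
      ∑ x, M (momentumUnit x) * M (lengthUnit (succ x)) := by
    rw [← sum_succ]
    simp only [pred_succ]
  have h2 : ∑ x : Fin N, M (lengthUnit (pred x)) * M (lengthUnit x) =
      ∑ x, M (lengthUnit x) * M (lengthUnit (succ x)) := by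
    rw [← sum_succ]
    simp only [pred_succ]
  have h3 : ∑ x : Fin N, M (lengthUnit (succ x)) ^ 2 = ∑ x, M (lengthUnit x) ^ 2 :=
    sum_succ fun x => M (lengthUnit x) ^ 2
  have hl : ∀ x : Fin N,
      β⁻¹ * (2 * M (momentumUnit x) * -M (drift N β k γ a (momentumUnit x))) +
      (2 * k * β)⁻¹ * (2 * M (lengthUnit x) * -M (drift N β k γ a (lengthUnit x))) =
      2 * a / β * (M (momentumUnit x) * M (lengthUnit (succ x))) -
      2 * a / β * (M (momentumUnit (pred x)) * M (lengthUnit x)) -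
      a * γ * (M (lengthUnit x) * M (lengthUnit (succ x))) -
      a * γ * (M (lengthUnit (pred x)) * M (lengthUnit x)) +
      2 * a * γ * M (lengthUnit x) ^ 2 := by
    intro x
    rw [drift_momentumUnit, drift_lengthUnit]
    simp only [map_add, map_sub, map_smul, smul_eq_mul]
    field_simp
    ring
  have hr : ∀ x : Fin N, M (noiseDir γ a x) ^ 2 = a * γ * M (lengthUnit (succ x)) ^ 2 -
      2 * a * γ * (M (lengthUnit x) * M (lengthUnit (succ x))) +
      a * γ * M (lengthUnit x) ^ 2 := by
    intro x
    rw [noiseDir, map_smul, smul_eq_mul, mul_pow, Real.sq_sqrt (by positivity), map_sub]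
    ring
  simp only [hl, hr, Finset.sum_add_distrib, Finset.sum_sub_distrib, ← Finset.mul_sum]
  rw [h1, h2, h3]
  ring

/-- By the Lyapunov equation the integrand is the derivative in `s` of the Gibbs variance of `L ∘
exp ((t - s) A)`. The accumulated noise thus restores exactly the variance that the flow `exp (t A)`
removes. -/
theorem integral_noiseDir_eq (hβ : 0 < β) (hk : 0 < k) (hγ : 0 ≤ γ) (ha : 0 ≤ a)
    (L : StrongDual ℝ (Config N)) (t : ℝ) :
    ∫ s in (0 : ℝ)..t,
      ∑ x, L (NormedSpace.exp ((t - s) • drift N β k γ a) (noiseDir γ a x)) ^ 2 =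
    dualVar (β⁻¹).toNNReal ((2 * k * β)⁻¹).toNNReal L -
      dualVar (β⁻¹).toNNReal ((2 * k * β)⁻¹).toNNReal
        (L.comp (NormedSpace.exp (t • drift N β k γ a))) := by
  have hU := continuous_exp_sub_smul (drift N β k γ a) t
  have hd : ∀ s, HasDerivAt (fun s => dualVar (β⁻¹).toNNReal ((2 * k * β)⁻¹).toNNReal
      (L.comp (NormedSpace.exp ((t - s) • drift N β k γ a))))
      (∑ x, L (NormedSpace.exp ((t - s) • drift N β k γ a) (noiseDir γ a x)) ^ 2) s := by
    intro s
    have hL : ∀ y : Config N, HasDerivAt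
        (fun s => L.comp (NormedSpace.exp ((t - s) • drift N β k γ a)) y)
        (-(L.comp (NormedSpace.exp ((t - s) • drift N β k γ a)) (drift N β k γ a y))) s := by
      intro y
      have := L.hasFDerivAt.comp_hasDerivAt s
        (hasDerivAt_exp_sub_smul_apply (drift N β k γ a) t s y)
      simpa [Function.comp_def] using this
    have h := sum_drift_eq_sum_noiseDir hβ hk hγ ha
      (L.comp (NormedSpace.exp ((t - s) • drift N β k γ a)))
    simp only [ContinuousLinearMap.comp_apply] at h
    rw [← h]
    refine HasDerivAt.fun_sum fun x _ => ?_
    have h1 := ((hL (momentumUnit x)).pow 2).const_mul ((β⁻¹).toNNReal : ℝ)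
    have h2 := ((hL (lengthUnit x)).pow 2).const_mul (((2 * k * β)⁻¹).toNNReal : ℝ)
    simpa using h1.fun_add h2
  rw [intervalIntegral.integral_eq_sub_of_hasDerivAt (fun s _ => hd s)
    (Continuous.intervalIntegrable (by fun_prop) _ _)]
  simp [ContinuousLinearMap.one_def]

end Drift

/-! ### The chain as a linear equation, and contraction of the relative entropy. -/

section EntropyContraction

variable {Ω : Type*} [MeasurableSpace Ω] {P : Measure Ω} {N : ℕ}
  {β k γ a : ℝ} {B : Fin N → ℝ≥0 → Ω → ℝ} {η : ℝ → Ω → Config N}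

theorem deriv_harmonic (k r : ℝ) : deriv (fun r : ℝ => k * r ^ 2) r = 2 * k * r := by
  simp
  ring

theorem sum_smul_noiseDir_apply (b : Fin N → ℝ) (y : Fin N) :
    (∑ x, b x • noiseDir γ a x) y = (0, √(a * γ) * (b (pred y) - b y)) := by
  rw [Finset.sum_apply]
  simp only [noiseDir, Pi.smul_apply, Pi.sub_apply, lengthUnit_apply, eq_succ_iff, Prod.mk_sub_mk,
    Prod.smul_mk, smul_eq_mul, sub_zero, mul_zero]
  rw [Prod.ext_iff, Prod.fst_sum, Prod.snd_sum]
  refine ⟨by simp, ?_⟩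
  simp only [mul_sub, Finset.sum_sub_distrib]
  simp [mul_comm]

/-- For a quadratic potential the forces are linear, so the chain has the form required by
`exists_map_eq_prod_map`. The coefficient `β γ k` of the drift is `(β γ / 2) (2 k)`. -/
theorem IsOscillatorChain.linear_eq
    (h : IsOscillatorChain P β (fun r => k * r ^ 2) γ a B η) :
    ∀ᵐ ω ∂P, ∀ s, 0 ≤ s → η s ω = η 0 ω + (∫ r in (0 : ℝ)..s, drift N β k γ a (η r ω)) +
      ∑ x, B x s.toNNReal ω • noiseDir γ a x := by
  filter_upwards [h.continuous_path, h.momentum_eq, h.length_eq] with ω hc hp hr s hs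
  have hint : IntervalIntegrable (fun r => drift N β k γ a (η r ω)) volume 0 s :=
    intervalIntegrable_of_mem (t := s) ((drift N β k γ a).continuous.comp_continuousOn
      (hc.mono Set.Icc_subset_Ici_self)) ⟨le_rfl, hs⟩ ⟨hs, le_rfl⟩
  funext x
  have h1 := (momentumProj x).intervalIntegral_comp_comm hint
  have h2 := (lengthProj x).intervalIntegral_comp_comm hint
  simp only [momentumProj_apply, lengthProj_apply, drift_apply] at h1 h2
  rw [Pi.add_apply, Pi.add_apply, sum_smul_noiseDir_apply, Prod.ext_iff]
  simp only [Prod.fst_add, Prod.snd_add]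
  rw [← h1, ← h2, hp s hs x, hr s hs x]
  simp only [deriv_harmonic]
  refine ⟨?_, ?_⟩
  · rw [add_zero]
    congr 2
    funext r
    ring
  · congr 3
    funext r
    ring

variable [IsProbabilityMeasure P]

/-- The relative entropy with respect to the transported Gibbs measure does not increase. -/
theorem IsOscillatorChain.klDiv_map_le
    (h : IsOscillatorChain P β (fun r => k * r ^ 2) γ a B η) (hβ : 0 < β) (hk : 0 < k)
    (hγ : 0 ≤ γ) (ha : 0 ≤ a) {t : ℝ} (ht : 0 ≤ t) (m : Config N) :
    klDiv (P.map (η t)) (gaussProd (β⁻¹).toNNReal ((2 * k * β)⁻¹).toNNReal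
        (NormedSpace.exp (t • drift N β k γ a) m)) ≤
      klDiv (P.map (η 0)) (gaussProd (β⁻¹).toNNReal ((2 * k * β)⁻¹).toNNReal m) := by
  obtain ⟨ρ, hρ, hchar, hmap⟩ := exists_map_eq_prod_map (drift N β k γ a) (noiseDir γ a)
    (fun x => (h.brownian x).toIsPreBrownianReal) h.measurable_noise h.indep_noise
    h.measurable_state h.continuous_path h.indep_initial h.linear_eq ht
  have hP : ∀ t, IsProbabilityMeasure (P.map (η t)) := fun t =>
    Measure.isProbabilityMeasure_map (h.measurable_state t).aemeasurable
  set A := NormedSpace.exp (t • drift N β k γ a) with hA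
  set f : Config N × Config N → Config N := fun z => A z.1 + z.2 with hf
  have hfm : Measurable f := by fun_prop
  -- The Gibbs measure with mean `A m` arises from the one with mean `m` by the same map and the
  -- same noise `ρ` as the law of the chain. In the characteristic functions this is the variance
  -- identity `integral_noiseDir_eq`.
  have hinv : gaussProd (β⁻¹).toNNReal ((2 * k * β)⁻¹).toNNReal (A m) =
      ((gaussProd (β⁻¹).toNNReal ((2 * k * β)⁻¹).toNNReal m).prod ρ).map f := by
    have : IsProbabilityMeasure
        (((gaussProd (β⁻¹).toNNReal ((2 * k * β)⁻¹).toNNReal m).prod ρ).map f) :=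
      Measure.isProbabilityMeasure_map hfm.aemeasurable
    refine Measure.ext_of_charFunDual (funext fun L => ?_)
    have e : charFunDual (((gaussProd (β⁻¹).toNNReal ((2 * k * β)⁻¹).toNNReal m).prod ρ).map f) L =
        charFunDual (gaussProd (β⁻¹).toNNReal ((2 * k * β)⁻¹).toNNReal m) (L.comp A) *
          charFunDual ρ L := by
      rw [charFunDual_apply, integral_map hfm.aemeasurable
        (Measurable.aestronglyMeasurable (by fun_prop)), charFunDual_apply, charFunDual_apply,
        ← integral_prod_mul]
      congr 1
      funext z
      rw [← Complex.exp_add, ← add_mul]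
      simp [hf]
    rw [e, hchar, charFunDual_gaussProd, charFunDual_gaussProd, ← Complex.exp_add,
      integral_noiseDir_eq hβ hk hγ ha]
    congr 1
    rw [← hA]
    change (L (A m) : ℂ) * Complex.I - _ = (L (A m) : ℂ) * Complex.I - _ + _
    push_cast
    ring
  rw [hinv, hmap]
  -- Data processing removes the map `f`. The common independent factor `ρ` then leaves the entropy
  -- unchanged.
  refine (InformationTheory.klDiv_map_le _ _ hfm).trans ?_
  rw [← Measure.compProd_const, ← Measure.compProd_const, klDiv_compProd_left]

end EntropyContraction

/-! ### Dissipativity of the drift and stability of the means. -/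

section EnergyEstimate

variable {N : ℕ} {β k γ a : ℝ}

/-- The Hamiltonian part is antisymmetric for the energy and sums to zero. The rest is `-2 k² β² a
γ` times the sum of the squared discrete gradients of the lengths. -/
theorem energyDual_drift_nonpos (hβ : 0 < β) (hk : 0 < k) (hγ : 0 ≤ γ) (ha : 0 ≤ a)
    (h : Config N) :
    energyDual (β⁻¹).toNNReal ((2 * k * β)⁻¹).toNNReal h (drift N β k γ a h) ≤ 0 := by
  rw [energyDual_apply, Real.coe_toNNReal _ (by positivity), Real.coe_toNNReal _ (by positivity)]
  have h1 : ∑ x, (h (pred x)).1 * (h x).2 = ∑ x, (h x).1 * (h (succ x)).2 := by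
    rw [← sum_succ]
    simp only [pred_succ]
  have h2 : ∑ x, (h (pred x)).2 * (h x).2 = ∑ x, (h x).2 * (h (succ x)).2 := by
    rw [← sum_succ]
    simp only [pred_succ]
  have h3 : ∑ x, (h (succ x)).2 ^ 2 = ∑ x, (h x).2 ^ 2 := sum_succ fun x => (h x).2 ^ 2
  have hl : ∀ x : Fin N, (h x).1 / β⁻¹ * (drift N β k γ a h x).1 +
      (h x).2 / (2 * k * β)⁻¹ * (drift N β k γ a h x).2 =
      2 * k * β * a * ((h x).1 * (h (succ x)).2) - 2 * k * β * a * ((h (pred x)).1 * (h x).2) +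
      2 * k ^ 2 * β ^ 2 * a * γ * ((h x).2 * (h (succ x)).2) +
      2 * k ^ 2 * β ^ 2 * a * γ * ((h (pred x)).2 * (h x).2) -
      4 * k ^ 2 * β ^ 2 * a * γ * (h x).2 ^ 2 := by
    intro x
    rw [drift_apply, div_inv_eq_mul, div_inv_eq_mul]
    ring
  have hr : ∑ x, ((h (succ x)).2 - (h x).2) ^ 2 = 2 * ∑ x, (h x).2 ^ 2 -
      2 * ∑ x, (h x).2 * (h (succ x)).2 := by
    have : ∀ x, ((h (succ x)).2 - (h x).2) ^ 2 =
        (h (succ x)).2 ^ 2 + (h x).2 ^ 2 - 2 * ((h x).2 * (h (succ x)).2) := fun x => by ring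
    simp only [this, Finset.sum_add_distrib, Finset.sum_sub_distrib, ← Finset.mul_sum, h3]
    ring
  have h0 : 0 ≤ 2 * k ^ 2 * β ^ 2 * a * γ * ∑ x, ((h (succ x)).2 - (h x).2) ^ 2 :=
    mul_nonneg (by positivity) (Finset.sum_nonneg fun x _ => sq_nonneg _)
  rw [hr] at h0
  simp only [hl, Finset.sum_add_distrib, Finset.sum_sub_distrib, ← Finset.mul_sum]
  rw [h1, h2]
  linarith

theorem two_mul_energyDual_le (v w : ℝ≥0) (d e : Config N) :
    2 * energyDual v w d e ≤ energy v w d + energy v w e := by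
  rw [energyDual_apply, energy, energy, Finset.mul_sum, ← Finset.sum_add_distrib]
  refine Finset.sum_le_sum fun x _ => ?_
  have h1 : 0 ≤ ((d x).1 - (e x).1) ^ 2 / v := by positivity
  have h2 : 0 ≤ ((d x).2 - (e x).2) ^ 2 / w := by positivity
  have e1 : (d x).1 ^ 2 / v + (d x).2 ^ 2 / w + ((e x).1 ^ 2 / v + (e x).2 ^ 2 / w) -
      2 * ((d x).1 / v * (e x).1 + (d x).2 / w * (e x).2) =
      ((d x).1 - (e x).1) ^ 2 / v + ((d x).2 - (e x).2) ^ 2 / w := by ring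
  linarith

theorem energy_nonneg (v w : ℝ≥0) (d : Config N) : 0 ≤ energy v w d :=
  Finset.sum_nonneg fun x _ => by positivity

theorem hasDerivAt_energy (v w : ℝ≥0) {e : ℝ → Config N} {e' : Config N} {s : ℝ}
    (he : HasDerivAt e e' s) :
    HasDerivAt (fun s => energy v w (e s)) (2 * energyDual v w (e s) e') s := by
  rw [energyDual_apply, Finset.mul_sum]
  refine HasDerivAt.fun_sum fun x _ => ?_
  have h1 := (momentumProj x).hasFDerivAt.comp_hasDerivAt s he
  have h2 := (lengthProj x).hasFDerivAt.comp_hasDerivAt s he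
  refine (((h1.pow 2).div_const (v : ℝ)).fun_add ((h2.pow 2).div_const (w : ℝ))).congr_deriv ?_
  simp only [Function.comp_apply, momentumProj_apply, lengthProj_apply, Nat.cast_ofNat,
    Nat.add_one_sub_one, pow_one]
  ring

/-- Stability of the harmonic chain with respect to the forcing. -/
theorem energy_le_of_hasDerivAt (hβ : 0 < β) (hk : 0 < k) (hγ : 0 ≤ γ) (ha : 0 ≤ a)
    {e f : ℝ → Config N} (h0 : e 0 = 0) {K t : ℝ} (ht : 0 ≤ t)
    (he : ∀ s, HasDerivAt e (drift N β k γ a (e s) + f s) s)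
    (hf : ∀ s, energy (β⁻¹).toNNReal ((2 * k * β)⁻¹).toNNReal (f s) ≤ K) :
    energy (β⁻¹).toNNReal ((2 * k * β)⁻¹).toNNReal (e t) ≤ Real.exp t * (K * t) := by
  set v := (β⁻¹).toNNReal
  set w := ((2 * k * β)⁻¹).toNNReal
  -- Grönwall with the integrating factor `exp (-s)`, which absorbs the energy of `e` produced when
  -- Young's inequality is applied to the forcing. As the drift contributes with a favourable sign,
  -- the growth rate depends neither on `N` nor on the speed `a`.
  have hd : ∀ s, HasDerivAt (fun s => Real.exp (-s) * energy v w (e s))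
      (-Real.exp (-s) * energy v w (e s) +
        Real.exp (-s) * (2 * energyDual v w (e s) (drift N β k γ a (e s) + f s))) s := by
    intro s
    have h1 : HasDerivAt (fun s : ℝ => Real.exp (-s)) (-Real.exp (-s)) s := by
      simpa using (hasDerivAt_neg s).exp
    exact h1.mul (hasDerivAt_energy v w (he s))
  have hK : 0 ≤ K := (energy_nonneg v w (f 0)).trans (hf 0)
  have h := (convex_Icc (0 : ℝ) t).image_sub_le_mul_sub_of_deriv_le
    (f := fun s => Real.exp (-s) * energy v w (e s)) (C := K)
    (fun s _ => (hd s).continuousAt.continuousWithinAt)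
    (fun s _ => (hd s).differentiableAt.differentiableWithinAt) (fun s hs => ?_) 0 ⟨le_rfl, ht⟩ t
    ⟨ht, le_rfl⟩ ht
  · have hz : energy v w (e 0) = 0 := by simp [h0, energy]
    rw [hz, mul_zero, sub_zero, sub_zero, Real.exp_neg, inv_mul_le_iff₀ (Real.exp_pos t)] at h
    exact h
  · rw [interior_Icc] at hs
    rw [(hd s).deriv, map_add, mul_add]
    have h1 := energyDual_drift_nonpos hβ hk hγ ha (e s)
    have h2 := two_mul_energyDual_le v w (e s) (f s)
    have h3 : Real.exp (-s) ≤ 1 := by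
      rw [Real.exp_le_one_iff]
      linarith [hs.1]
    have h4 := Real.exp_pos (-s)
    calc _ = Real.exp (-s) * (2 * energyDual v w (e s) (drift N β k γ a (e s)) +
          (2 * energyDual v w (e s) (f s) - energy v w (e s))) := by ring
      _ ≤ Real.exp (-s) * K := by
        refine mul_le_mul_of_nonneg_left ?_ h4.le
        have := hf s
        linarith
      _ ≤ K := by nlinarith

end EnergyEstimate

/-! ### Periodic functions sampled on the discrete circle. -/

section PeriodicFunctions

theorem exists_forall_abs_le_of_periodic {f : ℝ → ℝ} (hf : Continuous f)
    (hp : Function.Periodic f 1) : ∃ C, 0 ≤ C ∧ ∀ u, |f u| ≤ C := by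
  obtain ⟨C, hC⟩ := (isCompact_Icc (a := (0 : ℝ)) (b := 1)).exists_bound_of_continuousOn
    hf.continuousOn
  refine ⟨C, (norm_nonneg _).trans (hC 0 (by simp)), fun u => ?_⟩
  obtain ⟨y, hy, h⟩ := hp.exists_mem_Ico₀ one_pos u
  rw [h]
  exact hC y ⟨hy.1, hy.2.le⟩

theorem periodic_deriv {f : ℝ → ℝ} (hp : Function.Periodic f 1) :
    Function.Periodic (deriv f) 1 := by
  intro u
  rw [← deriv_comp_add_const]
  congr 1
  exact funext hp

/-- The second order Taylor bound for smooth periodic functions. -/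
theorem exists_taylor_bound {f : ℝ → ℝ} (hf : ContDiff ℝ (⊤ : ℕ∞) f)
    (hp : Function.Periodic f 1) :
    ∃ C, 0 ≤ C ∧ ∀ u h, |f (u + h) - f u - h * deriv f u| ≤ C * h ^ 2 := by
  have hf1 : ContDiff ℝ (⊤ : ℕ∞) (deriv f) := (contDiff_infty_iff_deriv.1 hf).2
  have hf2 : ContDiff ℝ (⊤ : ℕ∞) (deriv (deriv f)) := (contDiff_infty_iff_deriv.1 hf1).2
  have hd : Differentiable ℝ f := hf.differentiable (by simp)
  have hd1 : Differentiable ℝ (deriv f) := hf1.differentiable (by simp)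
  obtain ⟨C, hC, hb⟩ := exists_forall_abs_le_of_periodic hf2.continuous
    (periodic_deriv (periodic_deriv hp))
  refine ⟨C, hC, fun u h => ?_⟩
  have h1 : ∀ x y, |deriv f y - deriv f x| ≤ C * |y - x| := fun x y =>
    convex_univ.norm_image_sub_le_of_norm_deriv_le (fun z _ => hd1 z) (fun z _ => hb z)
      (Set.mem_univ x) (Set.mem_univ y)
  -- The remainder is the increment of `z ↦ f z - z f'(u)` from `u` to `u + h`. Between these points
  -- its derivative is at most `C |h|`.
  have h2 : ∀ z, HasDerivAt (fun z => f z - z * deriv f u) (deriv f z - deriv f u) z := fun z => by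
    simpa using (hd z).hasDerivAt.fun_sub ((hasDerivAt_id z).mul_const (deriv f u))
  have h3 := (convex_uIcc u (u + h)).norm_image_sub_le_of_norm_hasDerivWithin_le
    (fun z _ => (h2 z).hasDerivWithinAt) (C := C * |h|) (fun z hz => ?_)
    Set.left_mem_uIcc Set.right_mem_uIcc
  · rw [add_sub_cancel_left, Real.norm_eq_abs, Real.norm_eq_abs, mul_assoc, ← sq, sq_abs] at h3
    refine le_of_eq_of_le ?_ h3
    congr 1
    ring
  · refine (h1 u z).trans (mul_le_mul_of_nonneg_left ?_ hC)
    have := Set.abs_sub_left_of_mem_uIcc hz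
    simpa using this

/-- At the last site the successor is `0`, and the jump of the argument by 1 is absorbed by the
period. -/
theorem apply_succ_div_add {f : ℝ → ℝ} (hp : Function.Periodic f 1) {N : ℕ} (x : Fin N) (y : ℝ) :
    f ((succ x : ℕ) / N + y) = f ((x : ℕ) / N + y + 1 / N) := by
  cases N with
  | zero => exact x.elim0
  | succ n =>
    have hn : ((n : ℝ) + 1) ≠ 0 := by positivity
    rw [succ, finRotate_apply, Fin.val_add_one]
    split_ifs with h
    · rw [h, ← hp]
      congr 1
      simp
      field_simp
      ring
    · congr 1
      push_cast
      ring

theorem apply_pred_div_add {f : ℝ → ℝ} (hp : Function.Periodic f 1) {N : ℕ} (x : Fin N) (y : ℝ) :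
    f ((pred x : ℕ) / N + y) = f ((x : ℕ) / N + y + -(1 / N)) := by
  have h := apply_succ_div_add hp (pred x) (y - 1 / N)
  rw [succ_pred] at h
  rw [add_assoc, ← sub_eq_add_neg, h]
  congr 1
  ring

end PeriodicFunctions

/-! ### Travelling waves as approximate solutions of the lattice equation. -/

section Waves

variable {β k α κ p₀ r₀ : ℝ} {f g : ℝ → ℝ}

/-- The superposition of the wave `f` moving to the right and the wave `g` moving to the left. -/
noncomputable def waveProfile (k α κ p₀ r₀ : ℝ) (f g : ℝ → ℝ) (N : ℕ) (t : ℝ) : Config N :=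
  fun x =>
    (p₀ + (N : ℝ) ^ (-α) * (g ((x : ℕ) / N + (N : ℝ) ^ κ * √(2 * k) * t) * √(2 * k) -
      f ((x : ℕ) / N + -((N : ℝ) ^ κ * √(2 * k) * t)) * √(2 * k)),
    r₀ + (N : ℝ) ^ (-α) * (g ((x : ℕ) / N + (N : ℝ) ^ κ * √(2 * k) * t) +
      f ((x : ℕ) / N + -((N : ℝ) ^ κ * √(2 * k) * t))))

/-- The time derivative of `waveProfile`. -/
noncomputable def waveVelocity (k α κ : ℝ) (f g : ℝ → ℝ) (N : ℕ) (t : ℝ) : Config N :=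
  fun x =>
    ((N : ℝ) ^ (-α) * ((N : ℝ) ^ κ * √(2 * k)) * √(2 * k) *
      (deriv g ((x : ℕ) / N + (N : ℝ) ^ κ * √(2 * k) * t) +
      deriv f ((x : ℕ) / N + -((N : ℝ) ^ κ * √(2 * k) * t))),
    (N : ℝ) ^ (-α) * ((N : ℝ) ^ κ * √(2 * k)) *
      (deriv g ((x : ℕ) / N + (N : ℝ) ^ κ * √(2 * k) * t) -
      deriv f ((x : ℕ) / N + -((N : ℝ) ^ κ * √(2 * k) * t))))

theorem hasDerivAt_waveProfile (hf : Differentiable ℝ f) (hg : Differentiable ℝ g) (N : ℕ)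
    (t : ℝ) :
    HasDerivAt (waveProfile k α κ p₀ r₀ f g N) (waveVelocity k α κ f g N t) t := by
  refine hasDerivAt_pi.2 fun x => ?_
  set v := (N : ℝ) ^ κ * √(2 * k) with hv
  have h1 : HasDerivAt (fun t => g ((x : ℕ) / N + v * t))
      (deriv g ((x : ℕ) / N + v * t) * v) t := by
    have := ((hasDerivAt_id t).const_mul v).const_add ((x : ℕ) / N : ℝ)
    simpa [Function.comp_def] using (hg _).hasDerivAt.comp t this
  have h2 : HasDerivAt (fun t => f ((x : ℕ) / N + -(v * t)))
      (-(deriv f ((x : ℕ) / N + -(v * t)) * v)) t := by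
    have := ((hasDerivAt_id t).const_mul v).neg.const_add ((x : ℕ) / N : ℝ)
    simpa [Function.comp_def] using (hf _).hasDerivAt.comp t this
  refine HasDerivAt.prodMk ?_ ?_
  · refine ((((h1.mul_const √(2 * k)).sub (h2.mul_const √(2 * k))).const_mul
      ((N : ℝ) ^ (-α))).const_add p₀).congr_deriv ?_
    ring
  · refine (((h1.add h2).const_mul ((N : ℝ) ^ (-α))).const_add r₀).congr_deriv ?_
    ring

/-- The waves solve the equations of the chain up to a second order error. -/
theorem energy_waveVelocity_sub_drift_le (hβ : 0 < β) (hk : 0 < k)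
    (hfp : Function.Periodic f 1) (hgp : Function.Periodic g 1) {C : ℝ} (hC : 0 ≤ C)
    (hfC : ∀ u h, |f (u + h) - f u - h * deriv f u| ≤ C * h ^ 2)
    (hgC : ∀ u h, |g (u + h) - g u - h * deriv g u| ≤ C * h ^ 2) {N : ℕ} (hN : 0 < N) {γ : ℝ}
    (hγ : 0 ≤ γ) (t : ℝ) :
    energy (β⁻¹).toNNReal ((2 * k * β)⁻¹).toNNReal (waveVelocity k α κ f g N t -
        drift N β k γ ((N : ℝ) ^ (1 + κ)) (waveProfile k α κ p₀ r₀ f g N t)) ≤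
      (N : ℝ) ^ (1 - 2 * α) * ((N : ℝ) ^ (κ - 1) * (1 + γ)) ^ 2 *
        (β * (4 * k * C) ^ 2 + 2 * k * β * (2 * √(2 * k) * C + 4 * β * k * C) ^ 2) := by
  have hN' : (0 : ℝ) < N := by exact_mod_cast hN
  set c := √(2 * k) with hc
  have hc0 : 0 ≤ c := Real.sqrt_nonneg _
  have hcc : c * c = 2 * k := Real.mul_self_sqrt (by positivity)
  set b := (N : ℝ) ^ (κ - α) with hb
  have hb0 : 0 < b := Real.rpow_pos_of_pos hN' _
  have e1 : (N : ℝ) ^ (-α) * (N : ℝ) ^ κ = b := by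
    rw [← Real.rpow_add hN', hb]
    congr 1
    ring
  have e2 : (N : ℝ) ^ (1 + κ) * (N : ℝ) ^ (-α) = b * N := by
    rw [← Real.rpow_add hN', hb, ← Real.rpow_add_one hN'.ne']
    congr 1
    ring
  have hbN : (b / N) ^ 2 * N = (N : ℝ) ^ (1 - 2 * α) * ((N : ℝ) ^ (κ - 1)) ^ 2 := by
    rw [hb, ← Real.rpow_sub_one hN'.ne', ← Real.rpow_natCast, ← Real.rpow_mul hN'.le,
      ← Real.rpow_add_one hN'.ne', ← Real.rpow_natCast, ← Real.rpow_mul hN'.le,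
      ← Real.rpow_add hN']
    congr 1
    push_cast
    ring
  -- The first order Taylor terms cancel because `√(2k)` is the sound speed, and the viscous term
  -- involves only second differences. Each remainder is at most `C / N²`; multiplied by `N^(1+κ)
  -- N^(-α) = b N`, it becomes of order `b / N`.
  have hsite : ∀ x, |(waveVelocity k α κ f g N t x -
      drift N β k γ ((N : ℝ) ^ (1 + κ)) (waveProfile k α κ p₀ r₀ f g N t) x).1| ≤
        b / N * (4 * k * C) ∧
      |(waveVelocity k α κ f g N t x -
      drift N β k γ ((N : ℝ) ^ (1 + κ)) (waveProfile k α κ p₀ r₀ f g N t) x).2| ≤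
        b / N * (2 * c * C + 4 * β * γ * k * C) := by
    intro x
    rw [drift_apply]
    simp only [waveVelocity, waveProfile, apply_succ_div_add hfp, apply_succ_div_add hgp,
      apply_pred_div_add hfp, apply_pred_div_add hgp, Prod.mk_sub_mk]
    rw [← hc]
    set u := (x : ℕ) / (N : ℝ) + (N : ℝ) ^ κ * c * t
    set w := (x : ℕ) / (N : ℝ) + -((N : ℝ) ^ κ * c * t)
    have hinv : C * (1 / (N : ℝ)) ^ 2 = C / N ^ 2 := by rw [div_pow, one_pow]; ring
    have hg1 := abs_le.1 (hgC u (1 / N))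
    have hg2 := abs_le.1 (hgC u (-(1 / N)))
    have hf1 := abs_le.1 (hfC w (1 / N))
    have hf2 := abs_le.1 (hfC w (-(1 / N)))
    rw [neg_sq] at hg2 hf2
    rw [hinv] at hg1 hg2 hf1 hf2
    set G1 := g (u + 1 / N) - g u - 1 / N * deriv g u with hG1
    set G2 := g (u + -(1 / N)) - g u - -(1 / N) * deriv g u with hG2
    set F1 := f (w + 1 / N) - f w - 1 / N * deriv f w with hF1
    set F2 := f (w + -(1 / N)) - f w - -(1 / N) * deriv f w with hF2
    have hbN2 : b / N = b * N * (1 / N ^ 2) := by field_simp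
    constructor
    · have : (N : ℝ) ^ (-α) * ((N : ℝ) ^ κ * c) * c * (deriv g u + deriv f w) -
          (N : ℝ) ^ (1 + κ) * (2 * k) * (r₀ + (N : ℝ) ^ (-α) * (g (u + 1 / N) + f (w + 1 / N)) -
            (r₀ + (N : ℝ) ^ (-α) * (g u + f w))) = -(b * N * (2 * k * (G1 + F1))) := by
        have l1 : (N : ℝ) ^ (-α) * ((N : ℝ) ^ κ * c) * c * (deriv g u + deriv f w) =
            b * (2 * k) * (deriv g u + deriv f w) := by rw [← hcc, ← e1]; ring
        have l2 : (N : ℝ) ^ (1 + κ) * (2 * k) * (r₀ + (N : ℝ) ^ (-α) *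
            (g (u + 1 / N) + f (w + 1 / N)) - (r₀ + (N : ℝ) ^ (-α) * (g u + f w))) =
            b * N * (2 * k * (g (u + 1 / N) + f (w + 1 / N) - (g u + f w))) := by
          rw [← e2]; ring
        rw [l1, l2, hG1, hF1]
        field_simp
        ring
      rw [this, abs_neg, abs_mul, abs_of_nonneg (by positivity), hbN2, mul_assoc (b * N)]
      refine mul_le_mul_of_nonneg_left ?_ (by positivity)
      rw [abs_mul, abs_of_nonneg (by positivity)]
      have : |G1 + F1| ≤ 2 * (C / N ^ 2) := abs_le.2 ⟨by linarith, by linarith⟩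
      calc _ ≤ 2 * k * (2 * (C / N ^ 2)) := mul_le_mul_of_nonneg_left this (by positivity)
        _ = _ := by ring
    · have : (N : ℝ) ^ (-α) * ((N : ℝ) ^ κ * c) * (deriv g u - deriv f w) -
          (N : ℝ) ^ (1 + κ) * (p₀ + (N : ℝ) ^ (-α) * (g u * c - f w * c) -
            (p₀ + (N : ℝ) ^ (-α) * (g (u + -(1 / N)) * c - f (w + -(1 / N)) * c)) +
            β * γ * k * (r₀ + (N : ℝ) ^ (-α) * (g (u + 1 / N) + f (w + 1 / N)) +
            (r₀ + (N : ℝ) ^ (-α) * (g (u + -(1 / N)) + f (w + -(1 / N)))) -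
            2 * (r₀ + (N : ℝ) ^ (-α) * (g u + f w)))) =
          b * N * (c * (G2 - F2) - β * γ * k * (G1 + G2 + F1 + F2)) := by
        have l1 : (N : ℝ) ^ (-α) * ((N : ℝ) ^ κ * c) * (deriv g u - deriv f w) =
            b * c * (deriv g u - deriv f w) := by rw [← e1]; ring
        have l2 : (N : ℝ) ^ (1 + κ) * (p₀ + (N : ℝ) ^ (-α) * (g u * c - f w * c) -
            (p₀ + (N : ℝ) ^ (-α) * (g (u + -(1 / N)) * c - f (w + -(1 / N)) * c)) +
            β * γ * k * (r₀ + (N : ℝ) ^ (-α) * (g (u + 1 / N) + f (w + 1 / N)) +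
            (r₀ + (N : ℝ) ^ (-α) * (g (u + -(1 / N)) + f (w + -(1 / N)))) -
            2 * (r₀ + (N : ℝ) ^ (-α) * (g u + f w)))) =
            b * N * (c * (g u - f w - (g (u + -(1 / N)) - f (w + -(1 / N)))) +
            β * γ * k * (g (u + 1 / N) + f (w + 1 / N) + (g (u + -(1 / N)) + f (w + -(1 / N))) -
            2 * (g u + f w))) := by
          rw [← e2]; ring
        have l3 : b * c * (deriv g u - deriv f w) =
            b * N * (c * (1 / N) * (deriv g u - deriv f w)) := by field_simp
        rw [l1, l2, l3, hG1, hF1, hG2, hF2]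
        ring
      rw [this, abs_mul, abs_of_nonneg (by positivity), hbN2, mul_assoc (b * N)]
      refine mul_le_mul_of_nonneg_left ?_ (by positivity)
      have h1 : |c * (G2 - F2)| ≤ c * (2 * (C / N ^ 2)) := by
        rw [abs_mul, abs_of_nonneg hc0]
        exact mul_le_mul_of_nonneg_left (abs_le.2 ⟨by linarith, by linarith⟩) hc0
      have h2 : |β * γ * k * (G1 + G2 + F1 + F2)| ≤ β * γ * k * (4 * (C / N ^ 2)) := by
        rw [abs_mul, abs_of_nonneg (by positivity)]
        exact mul_le_mul_of_nonneg_left (abs_le.2 ⟨by linarith, by linarith⟩) (by positivity)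
      refine (abs_sub _ _).trans ((add_le_add h1 h2).trans (le_of_eq ?_))
      ring
  have hbN0 : 0 ≤ b / N := by positivity
  calc _ ≤ ∑ _x : Fin N, (b / N) ^ 2 * ((1 + γ) ^ 2 *
        (β * (4 * k * C) ^ 2 + 2 * k * β * (2 * c * C + 4 * β * k * C) ^ 2)) := by
        refine Finset.sum_le_sum fun x _ => ?_
        obtain ⟨h1, h2⟩ := hsite x
        rw [Real.coe_toNNReal _ (by positivity), Real.coe_toNNReal _ (by positivity),
          div_inv_eq_mul, div_inv_eq_mul, ← sq_abs, ← sq_abs (Prod.snd _)]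
        -- Both coordinates are relaxed to contain the factor `1 + γ`, so that the dependence on `γ`
        -- factors out of the energy.
        have h3 : b / N * (4 * k * C) ≤ b / N * ((1 + γ) * (4 * k * C)) := by
          refine mul_le_mul_of_nonneg_left ?_ hbN0
          have : 0 ≤ γ * (4 * k * C) := by positivity
          linarith
        have h4 : b / N * (2 * c * C + 4 * β * γ * k * C) ≤
            b / N * ((1 + γ) * (2 * c * C + 4 * β * k * C)) := by
          refine mul_le_mul_of_nonneg_left ?_ hbN0
          have : 0 ≤ γ * (2 * c * C) + 4 * β * k * C := by positivity
          linarith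
        have h5 := pow_le_pow_left₀ (abs_nonneg _) (h1.trans h3) 2
        have h6 := pow_le_pow_left₀ (abs_nonneg _) (h2.trans h4) 2
        have h7 := mul_le_mul_of_nonneg_right h5 hβ.le
        have h8 := mul_le_mul_of_nonneg_right h6 (by positivity : 0 ≤ 2 * k * β)
        refine (add_le_add h7 h8).trans (le_of_eq ?_)
        ring
    _ = _ := by
        rw [Finset.sum_const, Finset.card_univ, Fintype.card_fin, nsmul_eq_mul,
          mul_pow ((N : ℝ) ^ (κ - 1)),
          ← mul_assoc ((N : ℝ) ^ (1 - 2 * α)), ← hbN]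
        ring

/-- The means of the transported Gibbs measures stay close to the waves. -/
theorem energy_waveProfile_sub_exp_le (hβ : 0 < β) (hk : 0 < k)
    (hf : ContDiff ℝ (⊤ : ℕ∞) f) (hg : ContDiff ℝ (⊤ : ℕ∞) g)
    (hfp : Function.Periodic f 1) (hgp : Function.Periodic g 1) (α κ p₀ r₀ : ℝ) :
    ∃ K, 0 ≤ K ∧ ∀ N : ℕ, 0 < N → ∀ γ : ℝ, 0 ≤ γ → ∀ t : ℝ, 0 ≤ t →
      energy (β⁻¹).toNNReal ((2 * k * β)⁻¹).toNNReal (waveProfile k α κ p₀ r₀ f g N t -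
        NormedSpace.exp (t • drift N β k γ ((N : ℝ) ^ (1 + κ)))
          (waveProfile k α κ p₀ r₀ f g N 0)) ≤
      Real.exp t * ((N : ℝ) ^ (1 - 2 * α) * ((N : ℝ) ^ (κ - 1) * (1 + γ)) ^ 2 * K * t) := by
  obtain ⟨C₁, hC₁, h₁⟩ := exists_taylor_bound hf hfp
  obtain ⟨C₂, hC₂, h₂⟩ := exists_taylor_bound hg hgp
  set C := max C₁ C₂ with hC
  have hC0 : 0 ≤ C := hC₁.trans (le_max_left _ _)
  refine ⟨β * (4 * k * C) ^ 2 + 2 * k * β * (2 * √(2 * k) * C + 4 * β * k * C) ^ 2,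
    by positivity, fun N hN γ hγ t ht => ?_⟩
  refine energy_le_of_hasDerivAt (a := (N : ℝ) ^ (1 + κ)) hβ hk hγ (by positivity)
    (e := fun t => waveProfile k α κ p₀ r₀ f g N t -
        NormedSpace.exp (t • drift N β k γ ((N : ℝ) ^ (1 + κ)))
          (waveProfile k α κ p₀ r₀ f g N 0))
    (f := fun t => waveVelocity k α κ f g N t -
        drift N β k γ ((N : ℝ) ^ (1 + κ)) (waveProfile k α κ p₀ r₀ f g N t)) ?_ ht (fun s => ?_)
    fun s => energy_waveVelocity_sub_drift_le hβ hk hfp hgp hC0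
      (fun u h => (h₁ u h).trans (mul_le_mul_of_nonneg_right (le_max_left _ _) (sq_nonneg _)))
      (fun u h => (h₂ u h).trans (mul_le_mul_of_nonneg_right (le_max_right _ _) (sq_nonneg _)))
      hN hγ s
  · simp
  · have h1 := hasDerivAt_waveProfile (k := k) (α := α) (κ := κ) (p₀ := p₀) (r₀ := r₀)
      (hf.differentiable (by simp)) (hg.differentiable (by simp)) N s
    have h2 := (hasDerivAt_exp_smul_const' (𝕂 := ℝ) (drift N β k γ ((N : ℝ) ^ (1 + κ))) s).clm_apply
      (hasDerivAt_const s (waveProfile k α κ p₀ r₀ f g N 0))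
    refine (h1.sub h2).congr_deriv ?_
    simp

end Waves

/-! ### Periodic Riemann sums and the degenerate Burgers equation. -/

section Limits

theorem uniformContinuous_of_periodic {f : ℝ → ℝ} (hf : Continuous f)
    (hp : Function.Periodic f 1) : UniformContinuous f := by
  rw [Metric.uniformContinuous_iff]
  intro ε hε
  obtain ⟨δ, hδ, h⟩ := Metric.uniformContinuousOn_iff.1
    ((isCompact_Icc (a := (-1 : ℝ)) (b := 2)).uniformContinuousOn_of_continuous
      hf.continuousOn) ε hε
  refine ⟨min δ 1, by positivity, fun {a b} hab => ?_⟩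
  -- Subtracting `⌊a⌋` from both points puts `a` in `[0, 1)`, and `b`, at distance less than 1, in
  -- `[-1, 2]`.
  rw [lt_min_iff, Real.dist_eq] at hab
  have e : ∀ y, f y = f (y - ⌊a⌋) := fun y => by
    have := hp.int_mul ⌊a⌋ (y - ⌊a⌋)
    rw [mul_one, sub_add_cancel] at this
    exact this
  rw [e a, e b]
  have h1 := Int.floor_le a
  have h2 := Int.lt_floor_add_one a
  have h3 := abs_lt.1 hab.2
  refine h _ ⟨by linarith, by linarith⟩ _ ⟨by linarith, by linarith⟩ ?_
  rw [Real.dist_eq, sub_sub_sub_cancel_right]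
  exact hab.1

/-- Shifted Riemann sums of a continuous periodic function, uniformly in the shift. -/
theorem tendsto_periodic_riemann_sum {f : ℝ → ℝ} (hf : Continuous f)
    (hp : Function.Periodic f 1) (y : ℕ → ℝ) :
    Tendsto (fun N : ℕ => 1 / (N : ℝ) * ∑ x : Fin N, f ((x : ℕ) / N + y N)) atTop
      (𝓝 (∫ u in (0 : ℝ)..1, f u)) := by
  rw [Metric.tendsto_atTop]
  intro ε hε
  obtain ⟨δ, hδ, h⟩ := Metric.uniformContinuous_iff.1 (uniformContinuous_of_periodic hf hp)
    (ε / 2) (by positivity)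
  have hlim : Tendsto (fun n : ℕ => 1 / (n : ℝ)) atTop (𝓝 0) :=
    tendsto_const_div_atTop_nhds_zero_nat 1
  obtain ⟨n₀, hn₀⟩ := eventually_atTop.1 (hlim.eventually (gt_mem_nhds hδ))
  refine ⟨n₀ + 1, fun n hn => ?_⟩
  have hn1 : 0 < n := by omega
  have hn' : (n : ℝ) ≠ 0 := by exact_mod_cast hn1.ne'
  have hshift : ∫ u in (0 : ℝ)..1, f u = ∫ u in (0 : ℝ)..1, f (u + y n) := by
    rw [intervalIntegral.integral_comp_add_right, add_comm (1 : ℝ), zero_add]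
    have := hp.intervalIntegral_add_eq 0 (y n)
    rwa [zero_add] at this
  have hc : Continuous fun u => f (u + y n) := by fun_prop
  rw [hshift, ← sum_integral_partition zero_le_one hc.continuousOn hn1, Finset.mul_sum,
    ← Finset.sum_range fun j => 1 / (n : ℝ) * f ((j : ℝ) / n + y n), Real.dist_eq,
    ← Finset.sum_sub_distrib]
  have hb : ∀ j ∈ Finset.range n, ‖1 / (n : ℝ) * f ((j : ℝ) / n + y n) -
      ∫ s in (j * 1 / n : ℝ)..((j + 1 : ℕ) * 1 / n), f (s + y n)‖ ≤ ε / 2 * (1 / n) := by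
    intro j _
    have e : 1 / (n : ℝ) * f ((j : ℝ) / n + y n) -
        ∫ s in (j * 1 / n : ℝ)..((j + 1 : ℕ) * 1 / n), f (s + y n) =
        ∫ s in (j * 1 / n : ℝ)..((j + 1 : ℕ) * 1 / n), (f ((j : ℝ) / n + y n) - f (s + y n)) := by
      rw [intervalIntegral.integral_sub intervalIntegrable_const (hc.intervalIntegrable _ _),
        intervalIntegral.integral_const, partition_sub, smul_eq_mul]
    have hpos : (0 : ℝ) ≤ 1 / n := by positivity
    rw [e, ← abs_of_nonneg hpos, ← partition_sub 1 j]
    refine intervalIntegral.norm_integral_le_of_norm_le_const fun s hs => ?_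
    rw [Set.uIoc_of_le (partition_le zero_le_one j)] at hs
    rw [← dist_eq_norm]
    refine (h ?_).le
    have h1 := partition_sub 1 (n := n) j
    have h2 := hn₀ n (by omega)
    have h3 : (j : ℝ) / n < s := by simpa using hs.1
    rw [mul_one (j : ℝ)] at h1
    rw [dist_comm, Real.dist_eq, add_sub_add_right_eq_sub, abs_of_nonneg (by linarith)]
    linarith [hs.2]
  refine (norm_sum_le_of_le _ hb).trans_lt ?_
  rw [Finset.sum_const, Finset.card_range, nsmul_eq_mul]
  field_simp
  norm_num

/-- With zero coefficient the equation says `∂ₛ σ = 0`. It is given only for `s > 0`, so the mean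
value theorem is combined with continuity up to `s = 0`. -/
theorem IsBurgersSolution.eq_initial {S : ℝ} {σIni : ℝ → ℝ} {σ : ℝ → ℝ → ℝ}
    (h : IsBurgersSolution 0 S σIni σ) {s : ℝ} (hs : s ∈ Set.Ico 0 S) (u : ℝ) :
    σ s u = σIni u := by
  rw [← h.initial u]
  rcases hs.1.eq_or_lt with h0 | h0
  · rw [← h0]
  have hmap : Set.MapsTo (fun s : ℝ => (s, u)) (Set.Ico 0 S) (Set.Ico 0 S ×ˢ Set.univ) :=
    fun r hr => ⟨hr, trivial⟩
  have hd : ContDiffOn ℝ (⊤ : ℕ∞) (fun s => σ s u) (Set.Ico 0 S) :=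
    h.smooth.comp (contDiff_id.prodMk contDiff_const).contDiffOn hmap
  have hsub : Set.Icc 0 s ⊆ Set.Ico 0 S := fun r hr => ⟨hr.1, hr.2.trans_lt hs.2⟩
  obtain ⟨r, hr, hr'⟩ := exists_deriv_eq_slope (fun s => σ s u) h0 (hd.continuousOn.mono hsub)
    fun r hr => ((hd.differentiableOn (by simp)).differentiableAt
      (Ico_mem_nhds hr.1 (hr.2.trans hs.2))).differentiableWithinAt
  have he := h.equation r ⟨hr.1, hr.2.trans hs.2⟩ u
  rw [zero_mul, add_zero, hr', sub_zero, div_eq_zero_iff, sub_eq_zero] at he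
  exact he.resolve_right h0.ne'

theorem tendsto_natCast_rpow_zero {a : ℝ} (ha : a < 0) :
    Tendsto (fun N : ℕ => (N : ℝ) ^ a) atTop (𝓝 0) := by
  have := (tendsto_rpow_neg_atTop (neg_pos.2 ha)).comp tendsto_natCast_atTop_atTop
  simpa [Function.comp_def] using this

end Limits

/-! ### Concentration of the empirical fields. -/

section Concentration

variable {N : ℕ}

/-- The linear part of the empirical field with weights `ψ`. -/
noncomputable def fieldDual (b c : ℝ) (ψ : Fin N → ℝ) : StrongDual ℝ (Config N) :=
  ∑ x, ((b * ψ x) • ((1 / 2 : ℝ) • lengthProj x + c • momentumProj x))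

theorem fieldDual_apply (b c : ℝ) (ψ : Fin N → ℝ) (h : Config N) :
    fieldDual b c ψ h = b * ∑ x, ((h x).2 / 2 + c * (h x).1) * ψ x := by
  simp only [fieldDual, sum_apply, smul_apply, add_apply, momentumProj_apply, lengthProj_apply,
    smul_eq_mul, Finset.mul_sum]
  exact Finset.sum_congr rfl fun x _ => by ring

theorem dualVar_fieldDual_le (v w : ℝ≥0) (b c : ℝ) {ψ : Fin N → ℝ} {C : ℝ}
    (hψ : ∀ x, |ψ x| ≤ C) :
    dualVar v w (fieldDual b c ψ) ≤ N * b ^ 2 * (C ^ 2 * (v * c ^ 2 + w / 4)) := by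
  have h1 : ∀ x, fieldDual b c ψ (momentumUnit x) = b * c * ψ x := by
    intro x
    rw [fieldDual_apply, Finset.sum_eq_single x]
    · simp [momentumUnit_apply]
      ring
    · intro y _ hy
      simp [momentumUnit_apply, hy]
    · simp
  have h2 : ∀ x, fieldDual b c ψ (lengthUnit x) = b / 2 * ψ x := by
    intro x
    rw [fieldDual_apply, Finset.sum_eq_single x]
    · simp [lengthUnit_apply]
      ring
    · intro y _ hy
      simp [lengthUnit_apply, hy]
    · simp
  simp only [dualVar, h1, h2]
  calc _ ≤ ∑ _x : Fin N, b ^ 2 * (C ^ 2 * (v * c ^ 2 + w / 4)) := by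
        refine Finset.sum_le_sum fun x _ => ?_
        have h3 : ψ x ^ 2 ≤ C ^ 2 := by
          rw [← sq_abs]
          exact pow_le_pow_left₀ (abs_nonneg _) (hψ x) 2
        have h4 : 0 ≤ b ^ 2 * (v * c ^ 2 + w / 4) := by positivity
        have h5 := mul_le_mul_of_nonneg_left h3 h4
        calc _ = b ^ 2 * (v * c ^ 2 + w / 4) * ψ x ^ 2 := by ring
          _ ≤ _ := h5
          _ = _ := by ring
    _ = _ := by
        rw [Finset.sum_const, Finset.card_univ, Fintype.card_fin, nsmul_eq_mul, mul_assoc]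

/-- A relative entropy of smaller order than `N ^ (1 - 2 α)` forces the empirical fields to
concentrate around their means under the reference measure. -/
theorem tendsto_measure_field {v w : ℝ≥0} {α c p₀ r₀ I : ℝ} (hα : α < 1 / 2)
    (μ : ∀ N, Measure (Config N)) [∀ N, IsProbabilityMeasure (μ N)] (m : ∀ N, Config N)
    (hkl : Tendsto (fun N : ℕ => klDiv (μ N) (gaussProd v w (m N)) /
        ENNReal.ofReal ((N : ℝ) ^ (1 - 2 * α))) atTop (𝓝 0))
    (ψ : ∀ N, Fin N → ℝ) {C : ℝ} (hψ : ∀ N x, |ψ N x| ≤ C) (F : ∀ N, Config N → ℝ)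
    (hF : ∀ N h, F N h = 1 / (N : ℝ) ^ (1 - α) *
      ∑ x, (((h x).2 - r₀) / 2 + c * ((h x).1 - p₀)) * ψ N x)
    (hmean : Tendsto (fun N => F N (m N)) atTop (𝓝 I)) {ε : ℝ} (hε : 0 < ε) :
    Tendsto (fun N => μ N {h | ε < |F N h - I|}) atTop (𝓝 0) := by
  set M : ℕ → ℝ := fun N => (N : ℝ) ^ (1 - 2 * α) with hM
  set H : ℕ → ℝ≥0∞ := fun N => klDiv (μ N) (gaussProd v w (m N)) with hH
  set D : ℝ := C ^ 2 * (v * c ^ 2 + w / 4) with hD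
  have hMpos : ∀ N : ℕ, 0 < N → 0 < M N := fun N hN =>
    Real.rpow_pos_of_pos (by exact_mod_cast hN) _
  -- The concentration bound is used with `lam = √q M`. This balances its two terms: the entropy
  -- term becomes `√q` and the variance term at most `√q D / 2`. The summand `log 2` keeps `q`
  -- positive, and it is negligible because `M → ∞` for `α < 1/2`.
  set q : ℕ → ℝ := fun N => ((H N).toReal + Real.log 2) / M N with hq
  have hqlim : Tendsto q atTop (𝓝 0) := by
    have h1 := (ENNReal.tendsto_toReal (ENNReal.zero_ne_top)).comp hkl
    have h2 := (tendsto_natCast_rpow_zero (a := -(1 - 2 * α)) (by linarith)).const_mul (Real.log 2)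
    have h3 := h1.add h2
    rw [ENNReal.toReal_zero, mul_zero, add_zero] at h3
    refine h3.congr' ?_
    filter_upwards [eventually_gt_atTop 0] with N hN
    simp only [hq, Function.comp_apply, ENNReal.toReal_div]
    rw [ENNReal.toReal_ofReal (hMpos N hN).le, Real.rpow_neg (Nat.cast_nonneg N), add_div,
      ← div_eq_mul_inv]
  have hbound : Tendsto (fun N => ENNReal.ofReal ((ε / 2)⁻¹ * (√(q N) + √(q N) * D / 2))) atTop
      (𝓝 0) := by
    have h1 : Tendsto (fun N => √(q N)) atTop (𝓝 0) := by
      have := (Real.continuous_sqrt.tendsto 0).comp hqlim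
      rwa [Real.sqrt_zero] at this
    have h2 := (h1.add ((h1.mul_const D).div_const 2)).const_mul (ε / 2)⁻¹
    have h3 := ENNReal.tendsto_ofReal h2
    simpa using h3
  refine tendsto_of_tendsto_of_tendsto_of_le_of_le' tendsto_const_nhds hbound
    (Eventually.of_forall fun _ => zero_le) ?_
  filter_upwards [eventually_gt_atTop 0, hkl.eventually (gt_mem_nhds zero_lt_one),
    Metric.tendsto_nhds.1 hmean (ε / 2) (by positivity)] with N hN hfin hm
  have hN' : (0 : ℝ) < N := by exact_mod_cast hN
  have hHfin : H N ≠ ⊤ := by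
    intro h
    simp only [hH] at h
    rw [h, ENNReal.top_div_of_ne_top ENNReal.ofReal_ne_top] at hfin
    exact absurd hfin (by simp)
  set L := fieldDual (1 / (N : ℝ) ^ (1 - α)) c (ψ N) with hL
  have hFL : ∀ h, F N h - F N (m N) = L h - L (m N) := by
    intro h
    rw [hF, hF, hL, fieldDual_apply, fieldDual_apply, ← mul_sub, ← mul_sub,
      ← Finset.sum_sub_distrib, ← Finset.sum_sub_distrib]
    congr 1
    exact Finset.sum_congr rfl fun x _ => by ring
  have hsub : {h | ε < |F N h - I|} ⊆ {h | ε / 2 < |L h - L (m N)|} := by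
    intro h hh
    rw [Real.dist_eq] at hm
    have h1 : |F N h - I| ≤ |F N h - F N (m N)| + |F N (m N) - I| := abs_sub_le _ _ _
    rw [hFL] at h1
    have h2 : ε < |F N h - I| := hh
    change ε / 2 < |L h - L (m N)|
    linarith
  have hqpos : 0 < q N := div_pos (add_pos_of_nonneg_of_pos ENNReal.toReal_nonneg
    (Real.log_pos (by norm_num))) (hMpos N hN)
  have hs := Real.sqrt_pos.2 hqpos
  refine (measure_mono hsub).trans ((measure_abs_sub_le (m N) L (μ N) hHfin
    (mul_pos hs (hMpos N hN)) (half_pos hε)).trans (ENNReal.ofReal_le_ofReal ?_))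
  refine mul_le_mul_of_nonneg_left (add_le_add (le_of_eq ?_) ?_) (by positivity)
  · have h1 : (H N).toReal + Real.log 2 = q N * M N := by
      rw [hq]
      field_simp [(hMpos N hN).ne']
    change (√(q N) * M N)⁻¹ * ((H N).toReal + Real.log 2) = √(q N)
    have h2 := (hMpos N hN).ne'
    rw [h1]
    nth_rewrite 2 [← Real.mul_self_sqrt hqpos.le]
    field_simp
  · have h1 := dualVar_fieldDual_le v w (1 / (N : ℝ) ^ (1 - α)) c (hψ N)
    -- The variance of the field is of order `1 / M`, which is exactly the scale at which an entropy
    -- `o(M)` is harmless.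
    have h2 : (N : ℝ) * (1 / (N : ℝ) ^ (1 - α)) ^ 2 = (M N)⁻¹ := by
      rw [one_div, ← Real.rpow_neg hN'.le, ← Real.rpow_natCast, ← Real.rpow_mul hN'.le, hM,
        ← Real.rpow_neg hN'.le, mul_comm, ← Real.rpow_add_one hN'.ne']
      congr 1
      push_cast
      ring
    rw [h2] at h1
    have h3 := mul_le_mul_of_nonneg_left h1 (mul_pos hs (hMpos N hN)).le
    have h4 : √(q N) * M N * ((M N)⁻¹ * D) = √(q N) * D := by
      have := (hMpos N hN).ne'
      field_simp
    rw [h4] at h3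
    linarith

end Concentration

/-! ### The chain data specialised to the harmonic potential. -/

namespace ChainData

variable {D : ChainData} {k : ℝ}

/-- `V'` and `𝛕` are the same linear function, so the first order Taylor remainder at `r̃ₓ` vanishes
pointwise. -/
theorem remainderIntegrand_harmonic (hk : 0 < k) (hV : D.V = fun r => k * r ^ 2) (hβ : 0 < D.β)
    (N : ℕ) (t : ℝ) (μ : Measure (Config N)) : D.remainderIntegrand N t μ = 0 := by
  funext η
  have h : ∀ r s : ℝ, deriv D.V r - tension D.β D.V s - tension' D.β D.V s * (r - s) = 0 := by
    intro r s
    rw [hV, deriv_harmonic, tension_harmonic hβ hk, tension'_harmonic hβ hk]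
    ring
  simp [remainderIntegrand, h]

theorem speed_harmonic (hk : 0 < k) (hV : D.V = fun r => k * r ^ 2) (hβ : 0 < D.β) :
    D.speed = √(2 * k) := by
  rw [speed, hV, tension'_harmonic hβ hk]

theorem burgersCoeff_harmonic (hk : 0 < k) (hV : D.V = fun r => k * r ^ 2) (hβ : 0 < D.β) :
    D.burgersCoeff = 0 := by
  rw [burgersCoeff, hV, tension''_harmonic hβ hk, zero_div]

theorem refMeasure_harmonic (hk : 0 < k) (hV : D.V = fun r => k * r ^ 2) (hβ : 0 < D.β) {N : ℕ}
    {t : ℝ} (hm : D.σm (D.slowTime N t) = D.σmIni) (hp : D.σp (D.slowTime N t) = D.σpIni) :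
    D.refMeasure N t = gaussProd (D.β⁻¹).toNNReal ((2 * k * D.β)⁻¹).toNNReal
      (waveProfile k D.α D.κ D.pStar D.rStar D.σmIni D.σpIni N t) := by
  unfold refMeasure gaussProd
  congr 1
  funext x
  rw [hV, siteGibbs_harmonic hβ hk]
  simp only [pProfile, rProfile, um, up, hm, hp, speed_harmonic hk hV hβ, waveProfile,
    sub_eq_add_neg]

/-- The profiles are controlled only on `[0, S)`. If `κ = α` the slow time is `t` itself; if `κ < α`
it tends to 0, so it lies in the interval only for large `N`. -/
theorem slowTime_mem {S T t : ℝ} (hκα : D.κ ≤ D.α) (hS : 0 < S) (hTS : D.κ = D.α → T < S)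
    (ht : t ∈ Set.Icc 0 T) : ∀ᶠ N : ℕ in atTop, D.slowTime N t ∈ Set.Ico 0 S := by
  have h0 : ∀ N : ℕ, 0 ≤ D.slowTime N t := fun N =>
    mul_nonneg (Real.rpow_nonneg (Nat.cast_nonneg N) _) ht.1
  rcases hκα.eq_or_lt with h | h
  · refine Eventually.of_forall fun N => ⟨h0 N, ?_⟩
    rw [slowTime, h, sub_self, Real.rpow_zero, one_mul]
    exact ht.2.trans_lt (hTS h)
  · have := (tendsto_natCast_rpow_zero (a := D.κ - D.α) (by linarith)).mul_const t
    rw [zero_mul] at this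
    filter_upwards [this.eventually (gt_mem_nhds hS)] with N hN
    exact ⟨h0 N, hN⟩

end ChainData

/-! ### Means of the empirical fields along the waves. -/

section FieldMeans

variable {k α κ p₀ r₀ : ℝ} {f g φ : ℝ → ℝ}

/-- This combination of length and momentum eliminates `f` exactly. The wave amplitude `N^(-α)`
turns the prefactor into `1 / N`, and the Riemann sum converges uniformly in the shift `N^κ √(2k)
t`, which may diverge. -/
theorem tendsto_fieldp_waveProfile (hk : 0 < k) (hg : Continuous g) (hgp : Function.Periodic g 1)
    (hφ : Continuous φ) (hφp : Function.Periodic φ 1) (t : ℝ) :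
    Tendsto (fun N : ℕ => 1 / (N : ℝ) ^ (1 - α) * ∑ x : Fin N,
      (((waveProfile k α κ p₀ r₀ f g N t x).2 - r₀) / 2 +
        1 / (2 * √(2 * k)) * ((waveProfile k α κ p₀ r₀ f g N t x).1 - p₀)) *
        φ ((x : ℕ) / N + (N : ℝ) ^ κ * √(2 * k) * t)) atTop (𝓝 (∫ u in (0 : ℝ)..1, g u * φ u)) := by
  have hc : √(2 * k) ≠ 0 := (Real.sqrt_pos.2 (by positivity)).ne'
  refine (tendsto_periodic_riemann_sum (hg.mul hφ) (hgp.mul hφp)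
    fun N => (N : ℝ) ^ κ * √(2 * k) * t).congr' ?_
  filter_upwards [eventually_gt_atTop 0] with N hN
  have hN' : (0 : ℝ) < N := by exact_mod_cast hN
  have e : 1 / (N : ℝ) = 1 / (N : ℝ) ^ (1 - α) * (N : ℝ) ^ (-α) := by
    rw [one_div, one_div, ← Real.rpow_neg hN'.le, ← Real.rpow_add hN', ← Real.rpow_neg_one]
    congr 1
    ring
  rw [e, mul_assoc, Finset.mul_sum]
  congr 1
  refine Finset.sum_congr rfl fun x _ => ?_
  simp only [waveProfile, Pi.mul_apply]
  field_simp
  ring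

theorem tendsto_fieldm_waveProfile (hk : 0 < k) (hf : Continuous f) (hfp : Function.Periodic f 1)
    (hφ : Continuous φ) (hφp : Function.Periodic φ 1) (t : ℝ) :
    Tendsto (fun N : ℕ => 1 / (N : ℝ) ^ (1 - α) * ∑ x : Fin N,
      (((waveProfile k α κ p₀ r₀ f g N t x).2 - r₀) / 2 +
        -(1 / (2 * √(2 * k))) * ((waveProfile k α κ p₀ r₀ f g N t x).1 - p₀)) *
        φ ((x : ℕ) / N + -((N : ℝ) ^ κ * √(2 * k) * t))) atTop
      (𝓝 (∫ u in (0 : ℝ)..1, f u * φ u)) := by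
  have hc : √(2 * k) ≠ 0 := (Real.sqrt_pos.2 (by positivity)).ne'
  refine (tendsto_periodic_riemann_sum (hf.mul hφ) (hfp.mul hφp)
    fun N => -((N : ℝ) ^ κ * √(2 * k) * t)).congr' ?_
  filter_upwards [eventually_gt_atTop 0] with N hN
  have hN' : (0 : ℝ) < N := by exact_mod_cast hN
  have e : 1 / (N : ℝ) = 1 / (N : ℝ) ^ (1 - α) * (N : ℝ) ^ (-α) := by
    rw [one_div, one_div, ← Real.rpow_neg hN'.le, ← Real.rpow_add hN', ← Real.rpow_neg_one]
    congr 1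
    ring
  rw [e, mul_assoc, Finset.mul_sum]
  congr 1
  refine Finset.sum_congr rfl fun x _ => ?_
  simp only [waveProfile, Pi.mul_apply]
  field_simp
  ring

end FieldMeans

/-- The relative entropy estimate for the harmonic chain. -/
theorem tendsto_klDiv_waveProfile {β k α κ p₀ r₀ : ℝ} {γ : ℕ → ℝ} {f g : ℝ → ℝ} (hβ : 0 < β)
    (hk : 0 < k) (hγ : ∀ N, 0 < γ N) (hκ : κ < 1)
    (hf : ContDiff ℝ (⊤ : ℕ∞) f) (hg : ContDiff ℝ (⊤ : ℕ∞) g)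
    (hfp : Function.Periodic f 1) (hgp : Function.Periodic g 1)
    {Ω : ℕ → Type*} [∀ N, MeasurableSpace (Ω N)] {P : ∀ N, Measure (Ω N)}
    [∀ N, IsProbabilityMeasure (P N)]
    {B : ∀ N, Fin N → ℝ≥0 → Ω N → ℝ} {η : ∀ N, ℝ → Ω N → Config N}
    (hη : ∀ N, IsOscillatorChain (P N) β (fun r => k * r ^ 2) (γ N) ((N : ℝ) ^ (1 + κ))
      (B N) (η N))
    (hγκ : γ =o[atTop] (fun N : ℕ => (N : ℝ) ^ (1 - κ)))
    (h0 : Tendsto (fun N : ℕ => klDiv ((P N).map (η N 0))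
        (gaussProd (β⁻¹).toNNReal ((2 * k * β)⁻¹).toNNReal (waveProfile k α κ p₀ r₀ f g N 0)) /
        ENNReal.ofReal ((N : ℝ) ^ (1 - 2 * α))) atTop (𝓝 0)) {t : ℝ} (ht : 0 ≤ t) :
    Tendsto (fun N : ℕ => klDiv ((P N).map (η N t))
        (gaussProd (β⁻¹).toNNReal ((2 * k * β)⁻¹).toNNReal (waveProfile k α κ p₀ r₀ f g N t)) /
        ENNReal.ofReal ((N : ℝ) ^ (1 - 2 * α))) atTop (𝓝 0) := by
  obtain ⟨K, hK, hbound⟩ := energy_waveProfile_sub_exp_le hβ hk hf hg hfp hgp α κ p₀ r₀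
  have hv : (β⁻¹).toNNReal ≠ 0 := by simpa using hβ
  have hw : ((2 * k * β)⁻¹).toNNReal ≠ 0 := by
    have : 0 < (2 * k * β)⁻¹ := by positivity
    simpa using this
  -- The upper bound `γ_N ≪ N^(1-κ)` enters here: it makes the squared distance of the means
  -- `o(N^(1-2α))`.
  have hb : Tendsto (fun N : ℕ => (N : ℝ) ^ (κ - 1) * (1 + γ N)) atTop (𝓝 0) := by
    have h1 := tendsto_natCast_rpow_zero (a := κ - 1) (by linarith)
    have h2 := h1.add hγκ.tendsto_div_nhds_zero
    rw [add_zero] at h2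
    refine h2.congr fun N => ?_
    rw [mul_add, mul_one, ← neg_sub 1 κ, Real.rpow_neg (Nat.cast_nonneg N)]
    ring
  have hlim : Tendsto (fun N : ℕ => 2 * (klDiv ((P N).map (η N 0))
        (gaussProd (β⁻¹).toNNReal ((2 * k * β)⁻¹).toNNReal (waveProfile k α κ p₀ r₀ f g N 0)) /
        ENNReal.ofReal ((N : ℝ) ^ (1 - 2 * α))) +
        ENNReal.ofReal (Real.exp t * (((N : ℝ) ^ (κ - 1) * (1 + γ N)) ^ 2 * K * t)))
      atTop (𝓝 0) := by
    have h1 := ENNReal.Tendsto.const_mul (a := 2) h0 (Or.inr (by simp))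
    have h2 := ENNReal.tendsto_ofReal ((((hb.pow 2).mul_const K).mul_const t).const_mul
      (Real.exp t))
    have h3 := h1.add h2
    simpa using h3
  refine tendsto_of_tendsto_of_tendsto_of_le_of_le' tendsto_const_nhds hlim
    (Eventually.of_forall fun _ => zero_le) ?_
  filter_upwards [eventually_gt_atTop 0] with N hN
  have hM : 0 < (N : ℝ) ^ (1 - 2 * α) := Real.rpow_pos_of_pos (by exact_mod_cast hN) _
  have : IsProbabilityMeasure ((P N).map (η N t)) :=
    Measure.isProbabilityMeasure_map ((hη N).measurable_state t).aemeasurable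
  -- The transported mean `exp (t A) m(0)` is exchanged for the wave at time `t`; contraction then
  -- bounds the entropy by its initial value.
  have h1 := klDiv_gaussProd_le hv hw (NormedSpace.exp (t • drift N β k (γ N) ((N : ℝ) ^ (1 + κ)))
    (waveProfile k α κ p₀ r₀ f g N 0)) (waveProfile k α κ p₀ r₀ f g N t) ((P N).map (η N t))
  have h2 := (hη N).klDiv_map_le hβ hk (hγ N).le (Real.rpow_nonneg (Nat.cast_nonneg N) _) ht
    (waveProfile k α κ p₀ r₀ f g N 0)
  have h3 := hbound N hN (γ N) (hγ N).le t ht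
  have h4 : Real.exp t * ((N : ℝ) ^ (1 - 2 * α) * ((N : ℝ) ^ (κ - 1) * (1 + γ N)) ^ 2 * K * t) =
      Real.exp t * (((N : ℝ) ^ (κ - 1) * (1 + γ N)) ^ 2 * K * t) * (N : ℝ) ^ (1 - 2 * α) := by
    ring
  rw [h4] at h3
  have h5 : ENNReal.ofReal ((N : ℝ) ^ (1 - 2 * α)) ≠ 0 := by simpa using hM
  rw [ENNReal.div_le_iff h5 ENNReal.ofReal_ne_top, add_mul, mul_assoc (2 : ℝ≥0∞),
    ENNReal.div_mul_cancel h5 ENNReal.ofReal_ne_top, ← ENNReal.ofReal_mul (by positivity)]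
  exact h1.trans (add_le_add (mul_le_mul_right h2 2) (ENNReal.ofReal_le_ofReal h3))

end OscillatorChain

/-! ### Assembly of the corollary. -/

open OscillatorChain in
theorem mainTheorem5 (D : ChainData) (k T S : ℝ)
    -- the oscillators are harmonic
    (hk : 0 < k) (hV : ∀ r, D.V r = k * r ^ 2)
    -- standing assumptions on the parameters
    (hβ : 0 < D.β) (hγ : ∀ N, 0 < D.γ N) (hκ : 0 < D.κ) (hκα : D.κ ≤ D.α)
    -- smooth, mean zero initial perturbations
    (hm_smooth : ContDiff ℝ (⊤ : ℕ∞) D.σmIni) (hm_per : Function.Periodic D.σmIni 1)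
    (hm_mean : ∫ u in (0 : ℝ)..1, D.σmIni u = 0)
    (hp_smooth : ContDiff ℝ (⊤ : ℕ∞) D.σpIni) (hp_per : Function.Periodic D.σpIni 1)
    (hp_mean : ∫ u in (0 : ℝ)..1, D.σpIni u = 0)
    -- the decoupled Burgers system has the smooth solution `(σ_-, σ_+)` on `[0, S)`
    (hS : 0 < S)
    (hm : IsBurgersSolution D.burgersCoeff S D.σmIni D.σm)
    (hp : IsBurgersSolution (-D.burgersCoeff) S D.σpIni D.σp)
    -- the time horizon: below the lifespan if `κ = α`, arbitrary if `κ < α`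
    (hT : 0 < T) (hTS : D.κ = D.α → T < S)
    -- for each `N`, the chain of `N` oscillators run at speed `N ^ (1 + κ)`
    (Ω : ℕ → Type*) [∀ N, MeasurableSpace (Ω N)] (P : ∀ N, Measure (Ω N))
    [∀ N, IsProbabilityMeasure (P N)]
    (B : ∀ N, Fin N → ℝ≥0 → Ω N → ℝ) (η : ∀ N, ℝ → Ω N → Config N)
    (hη : ∀ N, IsOscillatorChain (P N) D.β D.V (D.γ N) ((N : ℝ) ^ (1 + D.κ)) (B N) (η N)) :
    -- `R_{N,t}` is identically zero
    (∀ N, ∀ t ∈ Set.Icc 0 T,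
      Integrable (D.remainderIntegrand N t ((P N).map (η N t))) (D.refMeasureTilde N t) ∧
      D.remainder N t ((P N).map (η N t)) = 0) ∧
    (D.α < 1 / 2 → D.κ < (1 - 2 * D.α) / 3 →
      (fun N : ℕ => (N : ℝ) ^ (5 * D.κ + 4 * D.α - 1)) =o[atTop] D.γ →
      D.γ =o[atTop] (fun N : ℕ => (N : ℝ) ^ (1 - D.κ)) →
      Tendsto (fun N : ℕ => klDiv ((P N).map (η N 0)) (D.refMeasure N 0) /
        ENNReal.ofReal ((N : ℝ) ^ (1 - 2 * D.α))) atTop (𝓝 0) →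
      -- the relative entropy estimate
      (∀ t ∈ Set.Icc 0 T,
        Tendsto (fun N : ℕ => klDiv ((P N).map (η N t)) (D.refMeasure N t) /
          ENNReal.ofReal ((N : ℝ) ^ (1 - 2 * D.α))) atTop (𝓝 0)) ∧
      -- the equilibrium perturbation law
      (∀ t ∈ Set.Icc 0 T, ∀ φ : ℝ → ℝ, Continuous φ → Function.Periodic φ 1 → ∀ ε > 0,
        Tendsto (fun N : ℕ => ((P N).map (η N t))
          {ζ | ε < |D.fieldm N t φ ζ - ∫ u in (0 : ℝ)..1, D.limitm t u * φ u|}) atTop (𝓝 0) ∧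
        Tendsto (fun N : ℕ => ((P N).map (η N t))
          {ζ | ε < |D.fieldp N t φ ζ - ∫ u in (0 : ℝ)..1, D.limitp t u * φ u|}) atTop (𝓝 0))) := by
  have hV' : D.V = fun r => k * r ^ 2 := funext hV
  refine ⟨fun N t _ => ?_, fun hα hκ' _ hγκ h0 => ?_⟩
  · rw [ChainData.remainder, ChainData.remainderIntegrand_harmonic hk hV' hβ]
    exact ⟨integrable_zero _ _ _, integral_zero _ _⟩
  have hκ1 : D.κ < 1 := by linarith
  rw [ChainData.burgersCoeff_harmonic hk hV' hβ] at hm hp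
  rw [neg_zero] at hp
  -- As long as the slow time stays in `[0, S)`, the amplitudes equal their initial values and the
  -- reference measure is the Gaussian product centred at the waves.
  have href : ∀ {N : ℕ} {t : ℝ}, D.slowTime N t ∈ Set.Ico 0 S →
      D.refMeasure N t = gaussProd (D.β⁻¹).toNNReal ((2 * k * D.β)⁻¹).toNNReal
        (waveProfile k D.α D.κ D.pStar D.rStar D.σmIni D.σpIni N t) := fun hs =>
    ChainData.refMeasure_harmonic hk hV' hβ (funext (hm.eq_initial hs))
      (funext (hp.eq_initial hs))
  have h0' : ∀ N, D.slowTime N 0 ∈ Set.Ico 0 S := fun N => by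
    rw [ChainData.slowTime, mul_zero]
    exact ⟨le_rfl, hS⟩
  simp only [href (h0' _)] at h0
  have hent : ∀ t ∈ Set.Icc 0 T, _ := fun t ht =>
    tendsto_klDiv_waveProfile hβ hk hγ hκ1 hm_smooth hp_smooth hm_per hp_per (hV' ▸ hη) hγκ h0
      ht.1
  have hspeed := ChainData.speed_harmonic hk hV' hβ
  refine ⟨fun t ht => ?_, fun t ht φ hφ hφp ε hε => ?_⟩
  · refine (hent t ht).congr' ?_
    filter_upwards [ChainData.slowTime_mem hκα hS hTS ht] with N hN
    rw [href hN]
  · have hprob : ∀ N, IsProbabilityMeasure ((P N).map (η N t)) := fun N =>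
      Measure.isProbabilityMeasure_map ((hη N).measurable_state t).aemeasurable
    obtain ⟨C, -, hC⟩ := exists_forall_abs_le_of_periodic hφ hφp
    -- In both regimes the limit is the initial profile: by definition if `κ < α`, and because the
    -- Burgers evolution is trivial if `κ = α`.
    have hlim : D.limitm t = D.σmIni ∧ D.limitp t = D.σpIni := by
      unfold ChainData.limitm ChainData.limitp
      by_cases h : D.κ = D.α
      · have ht' : t ∈ Set.Ico 0 S := ⟨ht.1, ht.2.trans_lt (hTS h)⟩
        simp only [h, if_true]
        exact ⟨funext (hm.eq_initial ht'), funext (hp.eq_initial ht')⟩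
      · simp only [h, if_false, and_self]
    rw [hlim.1, hlim.2]
    constructor
    · refine tendsto_measure_field hα (fun N => (P N).map (η N t)) _ (hent t ht)
        (fun N x => φ (D.um N t ((x : ℕ) / N))) (fun N x => hC _) _ (c := -(1 / (2 * D.speed)))
        (p₀ := D.pStar) (r₀ := D.rStar) (fun N h => ?_) ?_ hε
      · rw [ChainData.fieldm]
        congr 1
        exact Finset.sum_congr rfl fun x _ => by ring
      · refine (tendsto_fieldm_waveProfile (g := D.σpIni) (α := D.α) (κ := D.κ) (p₀ := D.pStar)
          (r₀ := D.rStar) hk hm_smooth.continuous hm_per hφ hφp t).congr fun N => ?_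
        rw [ChainData.fieldm]
        congr 1
        refine Finset.sum_congr rfl fun x _ => ?_
        have hu : D.um N t ((x : ℕ) / N) = (x : ℕ) / N + -((N : ℝ) ^ D.κ * √(2 * k) * t) := by
          rw [ChainData.um, hspeed, sub_eq_add_neg]
        rw [hu, hspeed]
        ring
    · refine tendsto_measure_field hα (fun N => (P N).map (η N t)) _ (hent t ht)
        (fun N x => φ (D.up N t ((x : ℕ) / N))) (fun N x => hC _) _ (c := 1 / (2 * D.speed))
        (p₀ := D.pStar) (r₀ := D.rStar) (fun N h => ?_) ?_ hε
      · rw [ChainData.fieldp]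
        congr 1
        exact Finset.sum_congr rfl fun x _ => by ring
      · refine (tendsto_fieldp_waveProfile (f := D.σmIni) (α := D.α) (κ := D.κ) (p₀ := D.pStar)
          (r₀ := D.rStar) hk hp_smooth.continuous hp_per hφ hφp t).congr fun N => ?_
        rw [ChainData.fieldp]
        congr 1
        refine Finset.sum_congr rfl fun x _ => ?_
        rw [ChainData.up, hspeed]
        ring
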